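/- All spaces and algebras are over $\mathbb{C}$. A Banach algebra $\mathfrak{A}$ is called \emph{amenable} if it has an approximate diagonal, i.e., a bounded net $(\boldsymbol{d}_\alpha)_\alpha$ in the projective tensor product $\mathfrak{A} \hat{\otimes} \mathfrak{A}$ such that $$a \cdot \boldsymbol{d}_\alpha - \boldsymbol{d}_\alpha \cdot a \to 0 \quad\text{and}\quad a\,\Delta \boldsymbol{d}_\alpha \to a \qquad (a \in \mathfrak{A}),$$ where $a \cdot (x \otimes y) = ax \otimes y$, $(x \otimes y)\cdot a = x \otimes ya$, and $\Delta \colon \mathfrak{A} \hat{\otimes} \mathfrak{A} \to \mathfrak{A}$ is the bounded linear map with $\Delta(x \otimes y) = xy$. For a Banach space $E$, let $\mathcal{B}(E)$ and $\mathcal{K}(E)$ be the Banach algebras of bounded and of compact linear operators on $E$ with the operator norm. For a Banach algebra $\mathfrak{B}$, let $\ell^\infty(\mathfrak{B})$ be the Banach algebra of bounded sequences in $\mathfrak{B}$ with coordinatewise operations and the supremum norm. Write $\ell^p = \ell^p(\mathbb{N})$, and let $\ell^2 \oplus \ell^p$ carry the norm $\|(x,y)\| = \max\{\|x\|_2, \|y\|_p\}$.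 \textbf{Corollary.} Let $p \in (1,\infty)\setminus\{2\}$ be such that $\mathcal{B}(\ell^p)$ is amenable. Then $\ell^\infty(\mathcal{K}(\ell^2 \oplus \ell^p))$ is amenable. -/

import Mathlib

open scoped TensorProduct ENNReal

noncomputable section

section Amenability

universe u

variable (A : Type u) [NonUnitalNormedRing A] [NormedSpace ℂ A]

/-- The projective tensor product of `A` with itself: the completion of the algebraic tensor
product over `ℂ`, which carries the projective norm
`‖t‖ = inf {∑ j, ‖xⱼ‖ * ‖yⱼ‖ | t = ∑ j, xⱼ ⊗ yⱼ}`. -/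
abbrev ProjTensorSquare : Type u :=
  UniformSpace.Completion (⨂[ℂ] _ : Fin 2, A)

variable {A}

/-- The elementary tensor `x ⊗ y`. -/
def ProjTensorSquare.tmul (x y : A) : ProjTensorSquare A :=
  ((⨂ₜ[ℂ] i : Fin 2, (![x, y] : Fin 2 → A) i : ⨂[ℂ] _ : Fin 2, A) : ProjTensorSquare A)

/-- The bounded extension to the completion of a bounded linear map on the algebraic tensor
product. -/
def ProjTensorSquare.extend {F : Type*} [NormedAddCommGroup F] [NormedSpace ℂ F] [CompleteSpace F]
    (f : (⨂[ℂ] _ : Fin 2, A) →L[ℂ] F) : ProjTensorSquare A →L[ℂ] F :=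
  f.extend (UniformSpace.Completion.toComplL (𝕜 := ℂ) (E := ⨂[ℂ] _ : Fin 2, A))

theorem ProjTensorSquare.extend_coe {F : Type*} [NormedAddCommGroup F] [NormedSpace ℂ F]
    [CompleteSpace F] (f : (⨂[ℂ] _ : Fin 2, A) →L[ℂ] F) (t : ⨂[ℂ] _ : Fin 2, A) :
    ProjTensorSquare.extend f (t : ProjTensorSquare A) = f t :=
  ContinuousLinearMap.extend_eq f
    (e := UniformSpace.Completion.toComplL (𝕜 := ℂ) (E := ⨂[ℂ] _ : Fin 2, A))
    UniformSpace.Completion.denseRange_coe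
    (UniformSpace.Completion.isUniformInducing_coe _) t

/-- The bounded operator `S ⊗ T` on the projective tensor product, `x ⊗ y ↦ S x ⊗ T y`. -/
def ProjTensorSquare.map (S T : A →L[ℂ] A) : ProjTensorSquare A →L[ℂ] ProjTensorSquare A :=
  ProjTensorSquare.extend ((UniformSpace.Completion.toComplL (𝕜 := ℂ)).comp
    (PiTensorProduct.mapL (𝕜 := ℂ) (E := fun _ : Fin 2 => A) (E' := fun _ : Fin 2 => A)
      (![S, T] : Fin 2 → (A →L[ℂ] A))))

theorem ProjTensorSquare.map_tmul (S T : A →L[ℂ] A) (x y : A) :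
    ProjTensorSquare.map S T (ProjTensorSquare.tmul x y) =
      ProjTensorSquare.tmul (S x) (T y) := by
  refine (ProjTensorSquare.extend_coe _ _).trans ?_
  simp only [ContinuousLinearMap.comp_apply, PiTensorProduct.mapL_apply,
    PiTensorProduct.map_tprod, ProjTensorSquare.tmul, UniformSpace.Completion.coe_toComplL]
  congr 2
  funext i
  fin_cases i <;> rfl

variable [IsScalarTower ℂ A A] [SMulCommClass ℂ A A]

/-- The module action `a · (x ⊗ y) = (a * x) ⊗ y`. -/
def ProjTensorSquare.leftAct (a : A) : ProjTensorSquare A →L[ℂ] ProjTensorSquare A :=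
  ProjTensorSquare.map (ContinuousLinearMap.mul ℂ A a) (ContinuousLinearMap.id ℂ A)

/-- The module action `(x ⊗ y) · a = x ⊗ (y * a)`. -/
def ProjTensorSquare.rightAct (a : A) : ProjTensorSquare A →L[ℂ] ProjTensorSquare A :=
  ProjTensorSquare.map (ContinuousLinearMap.id ℂ A) ((ContinuousLinearMap.mul ℂ A).flip a)

theorem ProjTensorSquare.leftAct_tmul (a x y : A) :
    ProjTensorSquare.leftAct a (ProjTensorSquare.tmul x y) = ProjTensorSquare.tmul (a * x) y :=
  ProjTensorSquare.map_tmul _ _ x y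

theorem ProjTensorSquare.rightAct_tmul (a x y : A) :
    ProjTensorSquare.rightAct a (ProjTensorSquare.tmul x y) = ProjTensorSquare.tmul x (y * a) :=
  ProjTensorSquare.map_tmul _ _ x y

variable (A) in
/-- The multiplication of `A` as a bounded bilinear map, `m ↦ m 0 * m 1`. -/
def mulMultilinear : ContinuousMultilinearMap ℂ (fun _ : Fin 2 => A) A where
  toFun m := m 0 * m 1
  map_update_add' {dec} m i x y := by
    obtain rfl : dec = instDecidableEqFin 2 := Subsingleton.elim _ _
    fin_cases i <;> simp [add_mul, mul_add]
  map_update_smul' {dec} m i c x := by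
    obtain rfl : dec = instDecidableEqFin 2 := Subsingleton.elim _ _
    fin_cases i
    · exact smul_mul_assoc c x (m 1)
    · exact mul_smul_comm c (m 0) x
  cont := by fun_prop

variable [CompleteSpace A]

variable (A) in
/-- The bounded linear map `Δ` on the projective tensor product with `Δ (x ⊗ y) = x * y`. -/
def ProjTensorSquare.diag : ProjTensorSquare A →L[ℂ] A :=
  ProjTensorSquare.extend
    (PiTensorProduct.liftIsometry ℂ (fun _ : Fin 2 => A) A (mulMultilinear A))

theorem ProjTensorSquare.diag_tmul (x y : A) :
    ProjTensorSquare.diag A (ProjTensorSquare.tmul x y) = x * y := by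
  refine (ProjTensorSquare.extend_coe _ _).trans ?_
  rw [PiTensorProduct.liftIsometry_apply_apply, PiTensorProduct.lift.tprod]
  rfl

variable (A) in
/-- A Banach algebra is amenable if it has an approximate diagonal: a bounded net `d` in the
projective tensor product with `a · d α - d α · a → 0` and `a * Δ (d α) → a` for every `a`. -/
def IsAmenableBanachAlgebra : Prop :=
  ∃ (ι : Type u) (_ : Preorder ι) (_ : IsDirectedOrder ι) (_ : Nonempty ι)
    (d : ι → ProjTensorSquare A),
    (∃ C : ℝ, ∀ α, ‖d α‖ ≤ C) ∧
    (∀ a : A, Filter.Tendsto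
      (fun α => ProjTensorSquare.leftAct a (d α) - ProjTensorSquare.rightAct a (d α))
      Filter.atTop (nhds 0)) ∧
    (∀ a : A, Filter.Tendsto (fun α => a * ProjTensorSquare.diag A (d α))
      Filter.atTop (nhds a))

end Amenability

section CompactOperators

variable (E : Type*) [NormedAddCommGroup E] [NormedSpace ℂ E]

/-- The compact operators on `E`, as a subalgebra of `B(E)`. -/
def compactOperatorAlgebra : NonUnitalSubalgebra ℂ (E →L[ℂ] E) where
  carrier := {T | IsCompactOperator T}
  add_mem' hS hT := IsCompactOperator.add hS hT
  zero_mem' := isCompactOperator_zero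
  smul_mem' c _ hT := IsCompactOperator.smul hT c
  mul_mem' {S _} _ hT := IsCompactOperator.clm_comp hT S

/-- The Banach algebra `K(E)` of compact operators on `E`: its algebra structure and its norm are
those of the subalgebra `compactOperatorAlgebra E` of `B(E)`. -/
def CompactOperators : Type _ := compactOperatorAlgebra E

instance : NonUnitalNormedRing (CompactOperators E) :=
  inferInstanceAs (NonUnitalNormedRing (compactOperatorAlgebra E))

instance : Module ℂ (CompactOperators E) :=
  inferInstanceAs (Module ℂ (compactOperatorAlgebra E))

instance : NormedSpace ℂ (CompactOperators E) where
  norm_smul_le c T := norm_smul_le c (T.1 : E →L[ℂ] E)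

instance : IsScalarTower ℂ (CompactOperators E) (CompactOperators E) :=
  inferInstanceAs (IsScalarTower ℂ (compactOperatorAlgebra E) (compactOperatorAlgebra E))

instance : SMulCommClass ℂ (CompactOperators E) (CompactOperators E) :=
  inferInstanceAs (SMulCommClass ℂ (compactOperatorAlgebra E) (compactOperatorAlgebra E))

instance [CompleteSpace E] : CompleteSpace (CompactOperators E) :=
  (isClosed_setOfPred_isCompactOperator (𝕜₁ := ℂ) (𝕜₂ := ℂ) (σ₁₂ := RingHom.id ℂ)
    (M₁ := E) (M₂ := E)).completeSpace_coe

end CompactOperators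

/-- The Banach algebra `ℓ^∞(B)` of bounded sequences in `B`, with the supremum norm and
coordinatewise operations. -/
abbrev EllInfty (B : Type*) [NonUnitalNormedRing B] : Type _ :=
  lp (fun _ : ℕ => B) ∞

end

/-! Put X = ℓ^p and E = ℓ² ⊕ ℓ^p. Approximate diagonals of B(X) are carried to ℓ^∞(K(E)) by
operators S ⊗ T. Neither S nor T is multiplicative: S only has to respect left multiplications, T
right multiplications, and the products S(x)T(y) have to depend on xy alone.

Two facts about X supply S and T. Since X is the ℓ^p-sum of countably many copies of itself, there
are contractive row projections V_n and row embeddings U_n, and every bounded sequence of operators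
on X is the diagonal of a block diagonal operator (`exists_blockDiagonal`). Moreover the finite
sections P_m of E factor as P_m = Q_m J_m through X, with J_m, Q_m compact and bounded in norm
independently of m: by Khintchine's inequality the Rademacher functions span uniformly complemented
Hilbert spaces in ℓ^p (`exists_hilbert_complemented`).

Let e : E → X and f : X → E be the projection onto and the inclusion of the second summand, so that
e f = id. With m = m(n) put S(x)_n = Q_m V_n x e and T(x)_n = f x U_n J_m. The inner e f cancels, so
S(x)_n T(y)_n = Q_m V_n (xy) U_n J_m. If a_n = P_m a_n P_m for all n and b is block diagonal with
blocks J_m a_n Q_m, then a S(x) = S(bx) and T(x) a = T(xb). Both conditions on a diagonal, tested at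
b, thus pass to a.

For 1 < p < ∞ every compact operator on E is the norm limit of its sections P_m T P_m. So finitely
many sequences can be perturbed to this form, with m chosen separately for each n; the uniform
bounds on J_m and Q_m keep S ⊗ T bounded. The assembly is `isAmenable_ellInfty_compactOperators`. -/

open scoped TensorProduct ENNReal

noncomputable section

open Filter Topology

/-! ### Compact operators turn pointwise convergence into norm convergence -/

section CompactConvergence

variable {X Y Z : Type*} [NormedAddCommGroup X] [NormedSpace ℂ X] [NormedAddCommGroup Y]
  [NormedSpace ℂ Y] [NormedAddCommGroup Z] [NormedSpace ℂ Z]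

/-- A bounded strongly null sequence of operators becomes norm null after composition with a
compact operator. -/
theorem tendsto_comp_compact_of_strongly_null {G : ℕ → Y →L[ℂ] Z} {K : ℝ} (hK : ∀ r, ‖G r‖ ≤ K)
    (hG : ∀ y, Tendsto (fun r => G r y) atTop (𝓝 0)) {T : X →L[ℂ] Y} (hT : IsCompactOperator T) :
    Tendsto (fun r => (G r).comp T) atTop (𝓝 0) := by
  rw [Metric.tendsto_atTop]
  intro ε hε
  have hK0 : 0 ≤ K := (norm_nonneg _).trans (hK 0)
  have hc := hT.isCompact_closure_image_closedBall (𝕜₁ := ℂ) (f := (T : X →ₗ[ℂ] Y)) 1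
  -- A finite net for the image of the unit ball; `K + 1` keeps the radius meaningful when `K = 0`.
  obtain ⟨t, -, htf, hcov⟩ := hc.finite_cover_balls (e := ε / (4 * (K + 1))) (by positivity)
  have hev : ∀ᶠ r in atTop, ∀ y ∈ t, ‖G r y‖ < ε / 4 := by
    rw [eventually_all_finite htf]
    intro y _
    have := (hG y).norm
    rw [norm_zero] at this
    exact this.eventually_lt_const (by positivity)
  obtain ⟨N, hN⟩ := eventually_atTop.1 hev
  refine ⟨N, fun r hr => ?_⟩
  rw [dist_zero_right]
  refine lt_of_le_of_lt (b := ε / 2) ?_ (by linarith)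
  refine ContinuousLinearMap.opNorm_le_of_unit_norm (𝕜 := ℂ) (by positivity) fun x hx => ?_
  have hmem : T x ∈ closure ((T : X →ₗ[ℂ] Y) '' Metric.closedBall 0 1) :=
    subset_closure ⟨x, by simp [hx], rfl⟩
  obtain ⟨y, hy, hxy⟩ := Set.mem_iUnion₂.1 (hcov hmem)
  have h1 : ‖T x - y‖ < ε / (4 * (K + 1)) := by simpa [dist_eq_norm] using hxy
  calc ‖(G r).comp T x‖ = ‖G r (T x - y) + G r y‖ := by simp
    _ ≤ ‖G r (T x - y)‖ + ‖G r y‖ := norm_add_le _ _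
    _ ≤ K * (ε / (4 * (K + 1))) + ε / 4 := by
        gcongr
        · exact (G r).le_of_opNorm_le_of_le (hK r) h1.le
        · exact (hN r hr y hy).le
    _ ≤ ε / 2 := by
        have : K * (ε / (4 * (K + 1))) ≤ ε / 4 := by
          rw [mul_div_assoc', div_le_div_iff₀ (by positivity) (by positivity)]
          nlinarith
        linarith

/-- If the functionals on `X` satisfy `φ ∘ G r → 0` for a bounded sequence `G`, then
`T ∘ G r → 0` for every compact operator `T`. -/
theorem tendsto_compact_comp_of_dual_null {G : ℕ → Z →L[ℂ] X} {K : ℝ} (hK : ∀ r, ‖G r‖ ≤ K)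
    (hG : ∀ φ : X →L[ℂ] ℂ, Tendsto (fun r => φ.comp (G r)) atTop (𝓝 0))
    {T : X →L[ℂ] Y} (hT : IsCompactOperator T) :
    Tendsto (fun r => T.comp (G r)) atTop (𝓝 0) := by
  -- Vectors on which each composite attains at least half its norm; it suffices that their images
  -- tend to zero.
  have hu : ∀ r, ∃ u : Z, ‖u‖ ≤ 1 ∧ ‖T.comp (G r)‖ ≤ 2 * ‖T (G r u)‖ := by
    intro r
    rcases eq_or_ne (T.comp (G r)) 0 with h | h
    · exact ⟨0, by simp, by simp [h]⟩
    · have hpos : 0 < ‖T.comp (G r)‖ := norm_pos_iff.2 h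
      obtain ⟨u, hu1, hu2⟩ := (T.comp (G r)).exists_lt_apply_of_lt_opNorm
        (show ‖T.comp (G r)‖ / 2 < _ by linarith)
      exact ⟨u, hu1.le, by simp only [ContinuousLinearMap.comp_apply] at hu2; linarith⟩
  choose u hu1 hu2 using hu
  have hc := hT.isCompact_closure_image_closedBall (𝕜₁ := ℂ) (f := (T : X →ₗ[ℂ] Y)) K
  -- The images stay in a compact set, and every functional tends to zero along them, so by
  -- Hahn–Banach zero is the only cluster point.
  have hlim : Tendsto (fun r => T (G r (u r))) atTop (𝓝 0) := by
    refine hc.tendsto_nhds_of_unique_mapClusterPt (Eventually.of_forall fun r => ?_) ?_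
    · refine subset_closure ⟨G r (u r), ?_, rfl⟩
      simpa using (G r).le_of_opNorm_le_of_le (hK r) (hu1 r)
    · intro y _ hy
      by_contra hne
      obtain ⟨ψ, -, hψ⟩ := exists_dual_vector ℂ y (norm_ne_zero_iff.2 hne)
      have h1 : Tendsto (fun r => ψ (T (G r (u r)))) atTop (𝓝 0) := by
        refine squeeze_zero_norm (a := fun r => ‖(ψ.comp T).comp (G r)‖) (fun r => ?_) ?_
        · simpa using ((ψ.comp T).comp (G r)).le_of_opNorm_le_of_le le_rfl (hu1 r)
        · simpa using (hG (ψ.comp T)).norm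
      have h2 : MapClusterPt (ψ y) atTop (fun r => ψ (T (G r (u r)))) :=
        hy.continuousAt_comp ψ.continuous.continuousAt
      have h3 : ψ y = 0 := by
        have hne : (𝓝 (ψ y) ⊓ 𝓝 0).NeBot := ClusterPt.mono h2 h1
        exact eq_of_nhds_neBot hne
      rw [h3] at hψ
      exact hne (by simpa using hψ.symm)
  refine squeeze_zero_norm (fun r => hu2 r) ?_
  simpa using (hlim.norm.const_mul 2)

end CompactConvergence

/-! ### Finite sections of ℓ^p and their convergence -/

section Truncation

variable (p : ℝ≥0∞) [Fact (1 ≤ p)]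

/-- The projection of `ℓ^p` onto the first `m` coordinates. -/
def lpTrunc (m : ℕ) : lp (fun _ : ℕ => ℂ) p →L[ℂ] lp (fun _ : ℕ => ℂ) p :=
  lp.mapCLM p (fun i => if i < m then ContinuousLinearMap.id ℂ ℂ else 0) zero_le_one
    (fun i => by split_ifs <;> simp)

variable {p}

theorem lpTrunc_apply (m : ℕ) (f : lp (fun _ : ℕ => ℂ) p) (i : ℕ) :
    lpTrunc p m f i = if i < m then f i else 0 := by
  simp only [lpTrunc, lp.mapCLM_apply_coe]
  split_ifs <;> simp

theorem norm_lpTrunc_le (m : ℕ) : ‖lpTrunc p m‖ ≤ 1 := lp.norm_mapCLM_le _ _ _ _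

theorem norm_id_sub_lpTrunc_le (m : ℕ) : ‖ContinuousLinearMap.id ℂ _ - lpTrunc p m‖ ≤ 1 := by
  refine ContinuousLinearMap.opNorm_le_bound _ zero_le_one fun f => ?_
  rw [one_mul]
  refine lp.norm_mono (zero_lt_one.trans_le Fact.out).ne' fun i => ?_
  simp only [sub_apply, ContinuousLinearMap.id_apply, lp.coeFn_sub,
    Pi.sub_apply, lpTrunc_apply]
  split_ifs <;> simp

theorem lpTrunc_comp_lpTrunc (m n : ℕ) :
    (lpTrunc p m).comp (lpTrunc p n) = lpTrunc p (min m n) := by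
  ext f i
  simp only [ContinuousLinearMap.comp_apply, lpTrunc_apply]
  grind

theorem lpTrunc_lpTrunc_self (m : ℕ) (f : lp (fun _ : ℕ => ℂ) p) :
    lpTrunc p m (lpTrunc p m f) = lpTrunc p m f := by
  rw [← ContinuousLinearMap.comp_apply, lpTrunc_comp_lpTrunc, min_self]

theorem lpTrunc_eq_sum (m : ℕ) (f : lp (fun _ : ℕ => ℂ) p) :
    lpTrunc p m f = ∑ i ∈ Finset.range m, lp.single p i (f i) := by
  ext j
  simp only [lpTrunc_apply, lp.coeFn_sum, Finset.sum_apply, lp.coeFn_single]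
  simp [Finset.sum_pi_single]

theorem isCompactOperator_lpTrunc (m : ℕ) : IsCompactOperator (lpTrunc p m) := by
  have h : lpTrunc p m = ∑ i ∈ Finset.range m,
      (lp.singleContinuousLinearMap ℂ (fun _ : ℕ => ℂ) p i).comp
        (lp.evalCLM ℂ (fun _ : ℕ => ℂ) p i) := by
    ext1 f
    rw [lpTrunc_eq_sum, sum_apply]
    rfl
  rw [h]
  have hid : IsCompactOperator (id : ℂ → ℂ) :=
    ⟨Metric.closedBall 0 1, isCompact_closedBall _ _, Metric.closedBall_mem_nhds _ one_pos⟩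
  refine sum_mem (S := compactOperator (RingHom.id ℂ) _ _) fun i _ => ?_
  exact (hid.comp_clm (lp.evalCLM ℂ (fun _ : ℕ => ℂ) p i)).clm_comp
    (lp.singleContinuousLinearMap ℂ (fun _ : ℕ => ℂ) p i)

theorem tendsto_lpTrunc (hp : p ≠ ∞) (f : lp (fun _ : ℕ => ℂ) p) :
    Tendsto (fun m => lpTrunc p m f) atTop (𝓝 f) := by
  simp only [lpTrunc_eq_sum]
  exact (lp.hasSum_single hp f).tendsto_sum_nat

/-- The two pieces have disjoint supports, so their p-th powers add. For p > 1 the bound is strictly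
below 2, and this gain forces functionals to decay on tails. -/
theorem norm_lpTrunc_add_le (hp : p ≠ ∞) (m : ℕ) {u v : lp (fun _ : ℕ => ℂ) p} (hu : ‖u‖ ≤ 1)
    (hv : ‖v‖ ≤ 1) : ‖lpTrunc p m u + (v - lpTrunc p m v)‖ ≤ 2 ^ (1 / p.toReal) := by
  have hp0 : 0 < p.toReal :=
    ENNReal.toReal_pos (zero_lt_one.trans_le (Fact.out : 1 ≤ p)).ne' hp
  refine lp.norm_le_of_forall_sum_le hp0 (by positivity) fun s => ?_
  rw [← Real.rpow_mul (by norm_num), one_div_mul_cancel hp0.ne', Real.rpow_one]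
  have h1 := (lp.sum_rpow_le_norm_rpow hp0 u s).trans (Real.rpow_le_one (norm_nonneg _) hu hp0.le)
  have h2 := (lp.sum_rpow_le_norm_rpow hp0 v s).trans (Real.rpow_le_one (norm_nonneg _) hv hp0.le)
  calc _ ≤ ∑ i ∈ s, (‖u i‖ ^ p.toReal + ‖v i‖ ^ p.toReal) := by
        refine Finset.sum_le_sum fun i _ => ?_
        simp only [lp.coeFn_add, lp.coeFn_sub, Pi.add_apply, Pi.sub_apply, lpTrunc_apply]
        have := Real.rpow_nonneg (norm_nonneg (u i)) p.toReal
        have := Real.rpow_nonneg (norm_nonneg (v i)) p.toReal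
        split_ifs <;> simp <;> assumption
    _ ≤ 2 := by rw [Finset.sum_add_distrib]; linarith

/-- For `1 < p < ∞` the coordinate functionals span a dense subspace of the dual of `ℓ^p`. -/
theorem tendsto_functional_comp_lpTrunc (hp1 : 1 < p) (hp : p ≠ ∞)
    (φ : lp (fun _ : ℕ => ℂ) p →L[ℂ] ℂ) :
    Tendsto (fun m => φ.comp (ContinuousLinearMap.id ℂ _ - lpTrunc p m)) atTop (𝓝 0) := by
  have hp0 : 1 < p.toReal := by
    rw [← ENNReal.toReal_one]; exact (ENNReal.toReal_lt_toReal (by simp) hp).2 hp1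
  set c : ℕ → ℝ := fun m => ‖φ.comp (ContinuousLinearMap.id ℂ _ - lpTrunc p m)‖ with hc
  have hcn : ∀ m, 0 ≤ c m := fun m => norm_nonneg _
  -- the inequality between two disjoint blocks
  have key : ∀ m, ∀ η > 0, ∃ M, c m + c M - η ≤ c m * 2 ^ (1 / p.toReal) := by
    intro m η hη
    obtain ⟨u, hu1, hu2⟩ : ∃ u : lp (fun _ : ℕ => ℂ) p, ‖u‖ ≤ 1 ∧
        c m - η / 2 < ‖φ (u - lpTrunc p m u)‖ := by
      obtain ⟨u, h1, h2⟩ := (φ.comp (ContinuousLinearMap.id ℂ _ -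
        lpTrunc p m)).exists_lt_apply_of_lt_opNorm (show c m - η / 2 < _ by simp [hc, hη])
      exact ⟨u, h1.le, by simpa using h2⟩
    have hlim : Tendsto (fun M => ‖φ (lpTrunc p M u - lpTrunc p m (lpTrunc p M u))‖) atTop
        (𝓝 ‖φ (u - lpTrunc p m u)‖) := by
      have h := tendsto_lpTrunc hp u
      exact ((φ.continuous.tendsto _).comp
        (h.sub (((lpTrunc p m).continuous.tendsto _).comp h))).norm
    obtain ⟨M, hM, hmM⟩ := ((hlim.eventually_const_lt hu2).and (eventually_ge_atTop m)).exists
    obtain ⟨v, hv1, hv2⟩ : ∃ v : lp (fun _ : ℕ => ℂ) p, ‖v‖ ≤ 1 ∧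
        c M - η / 2 < ‖φ (v - lpTrunc p M v)‖ := by
      obtain ⟨u, h1, h2⟩ := (φ.comp (ContinuousLinearMap.id ℂ _ -
        lpTrunc p M)).exists_lt_apply_of_lt_opNorm (show c M - η / 2 < _ by simp [hc, hη])
      exact ⟨u, h1.le, by simpa using h2⟩
    -- `u` cut at `M` and the tail of `v` beyond `M` nearly norm `φ` on disjoint blocks. Unimodular
    -- factors make both values of `φ` nonnegative, so that they add without cancellation.
    have phase : ∀ z : ℂ, ∃ w : ℂ, ‖w‖ = 1 ∧ w * z = ‖z‖ := by
      intro z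
      rcases eq_or_ne z 0 with rfl | hz
      · exact ⟨1, by simp, by simp⟩
      · have : (‖z‖ : ℂ) ≠ 0 := by simpa using hz
        exact ⟨‖z‖ / z, by simp [hz], by field_simp⟩
    obtain ⟨α, hα, hα'⟩ := phase (φ (lpTrunc p M u - lpTrunc p m (lpTrunc p M u)))
    obtain ⟨β, hβ, hβ'⟩ := phase (φ (v - lpTrunc p M v))
    refine ⟨M, ?_⟩
    have hw := norm_lpTrunc_add_le hp M (u := α • u) (v := β • v) (by simpa [norm_smul, hα])
      (by simpa [norm_smul, hβ])
    set w := lpTrunc p M (α • u) + (β • v - lpTrunc p M (β • v)) with hwdef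
    have hle := (φ.comp (ContinuousLinearMap.id ℂ _ - lpTrunc p m)).le_of_opNorm_le_of_le
      le_rfl hw
    have htr : lpTrunc p m (lpTrunc p M v) = lpTrunc p m v := by
      rw [← ContinuousLinearMap.comp_apply, lpTrunc_comp_lpTrunc, min_eq_left hmM]
    have heq : φ (w - lpTrunc p m w) =
        ((‖φ (lpTrunc p M u - lpTrunc p m (lpTrunc p M u))‖ + ‖φ (v - lpTrunc p M v)‖ : ℝ) : ℂ) := by
      push_cast
      rw [← hα', ← hβ', ← smul_eq_mul, ← smul_eq_mul, ← map_smul, ← map_smul, ← map_add]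
      congr 1
      simp only [hwdef, map_add, map_sub, map_smul, htr]
      module
    have hle' : ‖φ (w - lpTrunc p m w)‖ ≤ c m * 2 ^ (1 / p.toReal) := by
      simpa only [ContinuousLinearMap.comp_apply, sub_apply,
        ContinuousLinearMap.id_apply] using hle
    rw [heq, Complex.norm_real, Real.norm_of_nonneg (by positivity)] at hle'
    linarith
  have hanti : Antitone c := by
    intro m M hmM
    have h : φ.comp (ContinuousLinearMap.id ℂ _ - lpTrunc p M) =
        (φ.comp (ContinuousLinearMap.id ℂ _ - lpTrunc p m)).comp
          (ContinuousLinearMap.id ℂ _ - lpTrunc p M) := by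
      simp only [ContinuousLinearMap.comp_sub, ContinuousLinearMap.sub_comp,
        ContinuousLinearMap.comp_id, ContinuousLinearMap.comp_assoc, lpTrunc_comp_lpTrunc,
        min_eq_left hmM]
      abel
    simp only [hc]
    rw [h]
    refine (ContinuousLinearMap.opNorm_comp_le _ _).trans ?_
    exact mul_le_of_le_one_right (norm_nonneg _) (norm_id_sub_lpTrunc_le M)
  have hbdd : BddBelow (Set.range c) := ⟨0, by rintro _ ⟨m, rfl⟩; exact hcn m⟩
  have hlim := tendsto_atTop_ciInf hanti hbdd
  set L := ⨅ m, c m with hL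
  have hL0 : 0 ≤ L := le_ciInf hcn
  -- In the limit the block inequality reads 2L ≤ 2^(1/p) L, which leaves only L = 0.
  have h2 : L + L ≤ L * 2 ^ (1 / p.toReal) := by
    refine le_of_forall_pos_le_add fun η hη => ?_
    have h : ∀ m, L + L - η ≤ c m * 2 ^ (1 / p.toReal) := fun m => by
      obtain ⟨M, hM⟩ := key m η hη
      linarith [ciInf_le hbdd m, ciInf_le hbdd M]
    have := ge_of_tendsto' (hlim.mul_const _) h
    linarith
  have h3 : (2 : ℝ) ^ (1 / p.toReal) < 2 := by
    conv_rhs => rw [← Real.rpow_one 2]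
    exact Real.rpow_lt_rpow_of_exponent_lt (by norm_num) ((div_lt_one (by linarith)).2 hp0)
  have hLz : L = 0 := by nlinarith
  rw [hLz] at hlim
  exact tendsto_zero_iff_norm_tendsto_zero.2 hlim

/-- For `1 < p < ∞` a compact operator on `ℓ^p` is the norm limit of its truncations on the
right. -/
theorem tendsto_compact_comp_lpTrunc (hp1 : 1 < p) (hp : p ≠ ∞) {Y : Type*}
    [NormedAddCommGroup Y] [NormedSpace ℂ Y] {T : lp (fun _ : ℕ => ℂ) p →L[ℂ] Y}
    (hT : IsCompactOperator T) :
    Tendsto (fun m => T.comp (lpTrunc p m)) atTop (𝓝 T) := by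
  have h := tendsto_compact_comp_of_dual_null norm_id_sub_lpTrunc_le
    (tendsto_functional_comp_lpTrunc hp1 hp) hT
  have h' := (tendsto_const_nhds (x := T)).sub h
  simpa [ContinuousLinearMap.comp_sub] using h'

end Truncation

/-! ### Rademacher sums and Khintchine's inequality -/

section Rademacher

/-- The sign attached to a Boolean. -/
def boolSign (b : Bool) : ℝ := if b then 1 else -1

theorem boolSign_mul_self (b : Bool) : boolSign b * boolSign b = 1 := by
  cases b <;> simp [boolSign]

theorem boolSign_not (b : Bool) : boolSign (!b) = -boolSign b := by
  cases b <;> simp [boolSign]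

/-- Orthogonality of the Rademacher functions: flipping the `i`-th sign permutes the sign patterns
and negates the summand when `i ≠ j`. -/
theorem sum_boolSign_mul_boolSign {m : ℕ} (i j : Fin m) :
    ∑ ω : Fin m → Bool, boolSign (ω i) * boolSign (ω j) = if i = j then 2 ^ m else 0 := by
  split_ifs with h
  · subst h
    simp [boolSign_mul_self]
  · have hinv : Function.Involutive fun ω : Fin m → Bool => Function.update ω i (!ω i) := by
      intro ω; ext k; by_cases hk : k = i
      · subst hk; simp
      · simp [hk]
    have := Equiv.sum_comp hinv.toPerm fun ω : Fin m → Bool => boolSign (ω i) * boolSign (ω j)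
    simp only [Function.Involutive.coe_toPerm, Function.update_self,
      Function.update_of_ne (Ne.symm h), boolSign_not, neg_mul, Finset.sum_neg_distrib] at this
    linarith

/-- Independence factors the exponential moment into hyperbolic cosines, each estimated by cosh x ≤
exp(x²/2). -/
theorem sum_exp_rademacher_le {m : ℕ} (x : Fin m → ℝ) :
    ∑ ω : Fin m → Bool, Real.exp (∑ i, boolSign (ω i) * x i) ≤
      2 ^ m * Real.exp ((∑ i, x i ^ 2) / 2) := by
  have h : ∑ ω : Fin m → Bool, Real.exp (∑ i, boolSign (ω i) * x i) =
      ∏ i, ∑ b : Bool, Real.exp (boolSign b * x i) := by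
    rw [Finset.prod_univ_sum, Fintype.piFinset_univ]
    simp only [Real.exp_sum]
  rw [h, Finset.sum_div, Real.exp_sum]
  calc _ ≤ ∏ i, 2 * Real.exp (x i ^ 2 / 2) := by
        refine Finset.prod_le_prod (fun i _ => by positivity) fun i _ => ?_
        have := Real.cosh_le_exp_half_sq (x i)
        rw [Real.cosh_eq] at this
        simp [boolSign]
        linarith
    _ = _ := by rw [Finset.prod_mul_distrib]; simp

/-- Reduces moments of every order to exponential moments. -/
theorem exists_rpow_le_exp (q : ℝ) (hq : 0 < q) : ∃ C : ℝ, 0 < C ∧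
    ∀ t : ℝ, 0 ≤ t → t ^ q ≤ C * Real.exp t := by
  obtain ⟨n, hn⟩ := exists_nat_ge q
  refine ⟨1 + n.factorial, by positivity, fun t ht => ?_⟩
  have h1 : t ^ q ≤ 1 + t ^ n := by
    rcases le_total t 1 with h | h
    · have := Real.rpow_le_one ht h hq.le
      have := pow_nonneg ht n
      linarith
    · have := Real.rpow_le_rpow_of_exponent_le h hn
      rw [Real.rpow_natCast] at this
      linarith
  have h2 := Real.pow_div_factorial_le_exp t ht n
  rw [div_le_iff₀ (by positivity)] at h2
  have h3 := Real.one_le_exp ht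
  linarith

/-- The modulus is at most |re z| + |im z|, which is one of the four exponents on the right. This
reduces complex coefficients to real ones. -/
theorem exp_norm_le (z : ℂ) : Real.exp ‖z‖ ≤ Real.exp (z.re + z.im) + Real.exp (-(z.re + z.im)) +
    (Real.exp (z.re - z.im) + Real.exp (-(z.re - z.im))) := by
  have h := Complex.norm_le_abs_re_add_abs_im z
  have h' : |z.re| + |z.im| = z.re + z.im ∨ |z.re| + |z.im| = -(z.re + z.im) ∨
      |z.re| + |z.im| = z.re - z.im ∨ |z.re| + |z.im| = -(z.re - z.im) := by
    rcases abs_cases z.re with ⟨h1, _⟩ | ⟨h1, _⟩ <;> rcases abs_cases z.im with ⟨h2, _⟩ | ⟨h2, _⟩ <;>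
      rw [h1, h2] <;> grind
  have hm := Real.exp_le_exp.2 h
  have e1 := Real.exp_pos (z.re + z.im)
  have e2 := Real.exp_pos (-(z.re + z.im))
  have e3 := Real.exp_pos (z.re - z.im)
  have e4 := Real.exp_pos (-(z.re - z.im))
  rcases h' with h' | h' | h' | h' <;> rw [h'] at hm <;> linarith

theorem sum_exp_norm_rademacher_le {m : ℕ} (z : Fin m → ℂ) (hz : ∑ i, ‖z i‖ ^ 2 ≤ 1) :
    ∑ ω : Fin m → Bool, Real.exp ‖∑ i, (boolSign (ω i) : ℂ) * z i‖ ≤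
      2 ^ m * (4 * Real.exp 1) := by
  have hsq : ∀ i, ((z i).re + (z i).im) ^ 2 ≤ 2 * ‖z i‖ ^ 2 ∧
      ((z i).re - (z i).im) ^ 2 ≤ 2 * ‖z i‖ ^ 2 := fun i => by
    rw [Complex.sq_norm, Complex.normSq_apply]
    constructor <;> nlinarith [sq_nonneg ((z i).re + (z i).im), sq_nonneg ((z i).re - (z i).im)]
  have key : ∀ x : Fin m → ℝ, (∀ i, x i ^ 2 ≤ 2 * ‖z i‖ ^ 2) →
      ∑ ω : Fin m → Bool, Real.exp (∑ i, boolSign (ω i) * x i) ≤ 2 ^ m * Real.exp 1 := by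
    intro x hx
    refine (sum_exp_rademacher_le x).trans ?_
    gcongr
    have : ∑ i, x i ^ 2 ≤ ∑ i, 2 * ‖z i‖ ^ 2 := Finset.sum_le_sum fun i _ => hx i
    rw [← Finset.mul_sum] at this
    linarith
  have h1 := key (fun i => (z i).re + (z i).im) fun i => (hsq i).1
  have h2 := key (fun i => -((z i).re + (z i).im)) fun i => by rw [neg_sq]; exact (hsq i).1
  have h3 := key (fun i => (z i).re - (z i).im) fun i => (hsq i).2
  have h4 := key (fun i => -((z i).re - (z i).im)) fun i => by rw [neg_sq]; exact (hsq i).2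
  have hle : ∑ ω : Fin m → Bool, Real.exp ‖∑ i, (boolSign (ω i) : ℂ) * z i‖ ≤ _ :=
    Finset.sum_le_sum fun ω _ => exp_norm_le (∑ i, (boolSign (ω i) : ℂ) * z i)
  simp only [Complex.re_sum, Complex.im_sum, Complex.re_ofReal_mul, Complex.im_ofReal_mul,
    ← Finset.sum_add_distrib, ← Finset.sum_sub_distrib, ← mul_add, ← mul_sub,
    ← Finset.sum_neg_distrib, ← mul_neg] at hle
  simp only [Finset.sum_add_distrib] at hle
  simp only [Finset.sum_add_distrib, mul_add, mul_sub, Finset.sum_sub_distrib, mul_neg,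
    Finset.sum_neg_distrib] at hle h1 h2 h3 h4
  linarith

/-- The upper Khintchine inequality. -/
theorem exists_khintchine (q : ℝ) (hq : 0 < q) : ∃ K : ℝ, 0 < K ∧ ∀ (m : ℕ) (z : Fin m → ℂ) (N : ℝ),
    0 ≤ N → ∑ i, ‖z i‖ ^ 2 ≤ N ^ 2 →
      ∑ ω : Fin m → Bool, ‖∑ i, (boolSign (ω i) : ℂ) * z i‖ ^ q ≤ 2 ^ m * (K * N) ^ q := by
  obtain ⟨C, hC, hCt⟩ := exists_rpow_le_exp q hq
  refine ⟨(C * (4 * Real.exp 1)) ^ (1 / q), by positivity, fun m z N hN hz => ?_⟩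
  rw [Real.mul_rpow (by positivity) hN, ← Real.rpow_mul (by positivity), one_div_mul_cancel hq.ne',
    Real.rpow_one]
  -- The case `N = 0` is separate because the main case divides the coefficients by `N`.
  rcases hN.eq_or_lt with rfl | hN
  · have h0 : ∀ i, z i = 0 := by
      have h := (Finset.sum_eq_zero_iff_of_nonneg (s := Finset.univ)
        (fun i _ => sq_nonneg ‖z i‖)).1
        (le_antisymm (by simpa using hz) (Finset.sum_nonneg fun i _ => sq_nonneg ‖z i‖))
      intro i
      simpa using h i (Finset.mem_univ i)
    simp [h0, Real.zero_rpow hq.ne']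
  · have hz' : ∑ i, ‖z i / N‖ ^ 2 ≤ 1 := by
      simp only [norm_div, div_pow, ← Finset.sum_div, Complex.norm_real, Real.norm_eq_abs, sq_abs]
      exact div_le_one_of_le₀ hz (by positivity)
    have hs := sum_exp_norm_rademacher_le (fun i => z i / N) hz'
    calc _ ≤ ∑ ω : Fin m → Bool,
          C * Real.exp ‖∑ i, (boolSign (ω i) : ℂ) * (z i / N)‖ * N ^ q := by
          refine Finset.sum_le_sum fun ω _ => ?_
          have h := hCt ‖∑ i, (boolSign (ω i) : ℂ) * (z i / N)‖ (norm_nonneg _)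
          have heq : ‖∑ i, (boolSign (ω i) : ℂ) * z i‖ =
              ‖∑ i, (boolSign (ω i) : ℂ) * (z i / N)‖ * N := by
            simp only [mul_div_assoc', ← Finset.sum_div, norm_div, Complex.norm_real,
              Real.norm_of_nonneg hN.le]
            field_simp
          rw [heq, Real.mul_rpow (norm_nonneg _) hN.le]
          gcongr
      _ = C * (∑ ω : Fin m → Bool,
          Real.exp ‖∑ i, (boolSign (ω i) : ℂ) * (z i / N)‖) * N ^ q := by
          rw [Finset.mul_sum, Finset.sum_mul]
      _ ≤ C * (2 ^ m * (4 * Real.exp 1)) * N ^ q := by gcongr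
      _ = _ := by ring

end Rademacher

/-! ### Uniformly complemented Hilbert spaces in ℓ^p -/

section Complementation

variable {p : ℝ≥0∞}

theorem lp_norm_sum_single_embedding {Ω : Type*} [Fintype Ω] (e : Ω ↪ ℕ) (hp : 0 < p.toReal)
    (g : Ω → ℂ) : ‖∑ ω, lp.single (E := fun _ : ℕ => ℂ) p (e ω) (g ω)‖ ^ p.toReal =
      ∑ ω, ‖g ω‖ ^ p.toReal := by
  have h := lp.norm_sum_single hp (Function.extend e g 0) (Finset.univ.map e)
  simpa [Finset.sum_map, e.injective.extend_apply] using h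

theorem lp_sum_embedding_le {Ω : Type*} [Fintype Ω] (e : Ω ↪ ℕ) (hp : 0 < p.toReal)
    (f : lp (fun _ : ℕ => ℂ) p) : ∑ ω, ‖f (e ω)‖ ^ p.toReal ≤ ‖f‖ ^ p.toReal := by
  have h := lp.sum_rpow_le_norm_rpow hp f (Finset.univ.map e)
  simpa [Finset.sum_map] using h

/-- The finite-dimensional Hilbert spaces are uniformly complemented in `ℓ^p` for `1 < p < ∞`, by
means of the Rademacher functions. -/
theorem exists_hilbert_complemented [Fact (1 ≤ p)] (hp1 : 1 < p) (hp : p ≠ ∞) : ∃ K : ℝ, ∀ m : ℕ,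
    ∃ (J : lp (fun _ : ℕ => ℂ) 2 →L[ℂ] lp (fun _ : ℕ => ℂ) p)
      (Q : lp (fun _ : ℕ => ℂ) p →L[ℂ] lp (fun _ : ℕ => ℂ) 2),
      ‖J‖ ≤ K ∧ ‖Q‖ ≤ K ∧ Q.comp J = lpTrunc 2 m := by
  have hp0 : 1 < p.toReal := by
    rw [← ENNReal.toReal_one]; exact (ENNReal.toReal_lt_toReal (by simp) hp).2 hp1
  set r := p.toReal with hr
  have hr0 : 0 < r := by linarith
  obtain ⟨q, hpq⟩ : ∃ q, r.HolderConjugate q := ⟨_, Real.HolderConjugate.conjExponent hp0⟩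
  have hq0 : 0 < q := hpq.symm.pos
  obtain ⟨K₁, hK₁, hJ⟩ := exists_khintchine r hr0
  obtain ⟨K₂, hK₂, hQ⟩ := exists_khintchine q hq0
  refine ⟨max K₁ K₂, fun m => ?_⟩
  -- The 2^m sign patterns are coordinates of ℓ^p and play the role of a finite probability space.
  set e : (Fin m → Bool) ↪ ℕ := (Fintype.equivFin _).toEmbedding.trans Fin.valEmbedding
  set N : ℝ := 2 ^ m with hN
  have hN0 : 0 < N := by positivity
  -- Normalisations that turn counting measure on the sign patterns into probability measure in L^p
  -- and in L^q; conjugacy of the exponents gives `cp * cq * N = 1`.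
  set cp : ℝ := N ^ (-1 / r) with hcp
  set cq : ℝ := N ^ (-1 / q) with hcq
  have hcp0 : 0 < cp := by positivity
  have hcq0 : 0 < cq := by positivity
  have hcpr : cp ^ r * N = 1 := by
    rw [hcp, ← Real.rpow_mul hN0.le, div_mul_cancel₀ _ hr0.ne', Real.rpow_neg_one,
      inv_mul_cancel₀ hN0.ne']
  have hcqr : cq * N ^ (1 / q) = 1 := by
    rw [hcq, ← Real.rpow_add hN0]
    simp [neg_div]
  have hcpq : cp * cq * N = 1 := by
    have h : -1 / r + -1 / q = -1 := by
      have := hpq.inv_add_inv_eq_one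
      rw [neg_div, neg_div, one_div, one_div]
      linarith
    rw [hcp, hcq, ← Real.rpow_add hN0, h, Real.rpow_neg_one, inv_mul_cancel₀ hN0.ne']
  let Jl : lp (fun _ : ℕ => ℂ) 2 →ₗ[ℂ] lp (fun _ : ℕ => ℂ) p :=
    ∑ ω : Fin m → Bool, (lp.lsingle p (e ω)).comp
      ((cp : ℂ) • ∑ i : Fin m, (boolSign (ω i) : ℂ) • lp.evalₗ (fun _ : ℕ => ℂ) 2 (i : ℕ))
  let Ql : lp (fun _ : ℕ => ℂ) p →ₗ[ℂ] lp (fun _ : ℕ => ℂ) 2 :=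
    ∑ i : Fin m, (lp.lsingle 2 (i : ℕ)).comp
      ((cq : ℂ) • ∑ ω : Fin m → Bool, (boolSign (ω i) : ℂ) • lp.evalₗ (fun _ : ℕ => ℂ) p (e ω))
  have hJl : ∀ f, Jl f = ∑ ω : Fin m → Bool, lp.single (E := fun _ : ℕ => ℂ) p (e ω)
      ((cp : ℂ) * ∑ i : Fin m, (boolSign (ω i) : ℂ) * f i) := by
    intro f
    simp only [Jl, LinearMap.sum_apply, LinearMap.comp_apply, LinearMap.smul_apply]
    rfl
  have hQl : ∀ f, Ql f = ∑ i : Fin m, lp.single (E := fun _ : ℕ => ℂ) 2 (i : ℕ)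
      ((cq : ℂ) * ∑ ω : Fin m → Bool, (boolSign (ω i) : ℂ) * f (e ω)) := by
    intro f
    simp only [Ql, LinearMap.sum_apply, LinearMap.comp_apply, LinearMap.smul_apply]
    rfl
  have hJb : ∀ f, ‖Jl f‖ ≤ max K₁ K₂ * ‖f‖ := by
    intro f
    refine le_trans ?_ (mul_le_mul_of_nonneg_right (le_max_left _ _) (norm_nonneg _))
    rw [← Real.rpow_le_rpow_iff (norm_nonneg _) (by positivity) hr0, hJl,
      lp_norm_sum_single_embedding e hr0]
    have h1 : ∑ i : Fin m, ‖f i‖ ^ 2 ≤ ‖f‖ ^ 2 := by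
      have := lp_sum_embedding_le (p := 2) (Fin.valEmbedding (n := m)) (by simp) f
      simpa using this
    have h2 := hJ m (fun i => f i) ‖f‖ (norm_nonneg _) h1
    simp only [norm_mul, Complex.norm_real, Real.norm_of_nonneg hcp0.le]
    calc _ = cp ^ r * ∑ ω : Fin m → Bool, ‖∑ i : Fin m, (boolSign (ω i) : ℂ) * f i‖ ^ r := by
          rw [Finset.mul_sum]
          exact Finset.sum_congr rfl fun ω _ => Real.mul_rpow hcp0.le (norm_nonneg _)
      _ ≤ cp ^ r * (N * (K₁ * ‖f‖) ^ r) := by gcongr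
      _ = _ := by rw [← mul_assoc, hcpr, one_mul]
  have hQb : ∀ f, ‖Ql f‖ ≤ max K₁ K₂ * ‖f‖ := by
    intro f
    refine le_trans ?_ (mul_le_mul_of_nonneg_right (le_max_right _ _) (norm_nonneg _))
    set z : Fin m → ℂ := fun i => (cq : ℂ) * ∑ ω : Fin m → Bool, (boolSign (ω i) : ℂ) * f (e ω)
      with hz
    have h1 : ‖Ql f‖ ^ 2 = ∑ i, ‖z i‖ ^ 2 := by
      have := lp_norm_sum_single_embedding (p := 2) Fin.valEmbedding (by simp) z
      rw [hQl]
      simpa using this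
    have h2 := hQ m (fun i => star (z i)) ‖Ql f‖ (norm_nonneg _) (by simp [h1])
    -- Duality: the square of the norm is a pairing of `f` with a Rademacher sum, to be bounded by
    -- Hölder and Khintchine for the conjugate exponent, after which one factor `‖Ql f‖` cancels.
    have h3 : ((‖Ql f‖ ^ 2 : ℝ) : ℂ) = cq * ∑ ω : Fin m → Bool,
        f (e ω) * ∑ i, (boolSign (ω i) : ℂ) * star (z i) := by
      rw [h1]
      push_cast
      simp only [← Complex.mul_conj']
      simp only [Finset.mul_sum]
      rw [Finset.sum_comm]
      refine Finset.sum_congr rfl fun i _ => ?_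
      conv_lhs => arg 1; rw [hz]
      simp only [Finset.mul_sum, Finset.sum_mul]
      exact Finset.sum_congr rfl fun ω _ => by simp only [Complex.star_def]; ring
    have h4 : ‖Ql f‖ ^ 2 ≤ K₂ * ‖f‖ * ‖Ql f‖ := by
      have hn := congrArg norm h3
      rw [Complex.norm_real, Real.norm_of_nonneg (by positivity), norm_mul, Complex.norm_real,
        Real.norm_of_nonneg hcq0.le] at hn
      rw [hn]
      calc _ ≤ cq * ∑ ω : Fin m → Bool,
            ‖f (e ω)‖ * ‖∑ i, (boolSign (ω i) : ℂ) * star (z i)‖ := by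
            gcongr
            exact (norm_sum_le _ _).trans_eq (by simp only [norm_mul])
        _ ≤ cq * ((∑ ω : Fin m → Bool, ‖f (e ω)‖ ^ r) ^ (1 / r) * (∑ ω : Fin m → Bool,
              ‖∑ i, (boolSign (ω i) : ℂ) * star (z i)‖ ^ q) ^ (1 / q)) := by
            gcongr
            exact Real.inner_le_Lp_mul_Lq_of_nonneg _ hpq (fun _ _ => norm_nonneg _)
              fun _ _ => norm_nonneg _
        _ ≤ cq * ((‖f‖ ^ r) ^ (1 / r) * (N * (K₂ * ‖Ql f‖) ^ q) ^ (1 / q)) := by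
            gcongr
            exact lp_sum_embedding_le e hr0 f
        _ = (cq * N ^ (1 / q)) * (‖f‖ * (K₂ * ‖Ql f‖)) := by
            rw [Real.mul_rpow hN0.le (by positivity), ← Real.rpow_mul (norm_nonneg _),
              ← Real.rpow_mul (by positivity), mul_one_div_cancel hr0.ne',
              mul_one_div_cancel hq0.ne', Real.rpow_one, Real.rpow_one]
            ring
        _ = _ := by rw [hcqr]; ring
    rcases (norm_nonneg (Ql f)).eq_or_lt with h0 | h0
    · rw [← h0]; positivity
    · rw [sq] at h4; exact le_of_mul_le_mul_right h4 h0
  refine ⟨Jl.mkContinuous _ hJb, Ql.mkContinuous _ hQb,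
    Jl.mkContinuous_norm_le (by positivity) hJb, Ql.mkContinuous_norm_le (by positivity) hQb, ?_⟩
  ext1 f
  have hval : ∀ ω, (Jl f) (e ω) = cp * ∑ i : Fin m, (boolSign (ω i) : ℂ) * f i := by
    intro ω
    rw [hJl]
    simp only [lp.coeFn_sum, Finset.sum_apply, lp.coeFn_single]
    rw [Finset.sum_eq_single ω]
    · simp
    · intro ω' _ hne
      exact Pi.single_eq_of_ne (fun h => hne (e.injective h).symm) _
    · simp
  change Ql (Jl f) = _
  rw [hQl, lpTrunc_eq_sum, Finset.sum_range]
  refine Finset.sum_congr rfl fun i _ => ?_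
  congr 1
  simp only [hval, Finset.mul_sum]
  rw [Finset.sum_comm]
  -- Orthogonality of the Rademacher functions leaves only the `i`-th coordinate of `f`.
  have : ∀ j : Fin m, ∑ ω : Fin m → Bool,
      (cq : ℂ) * ((boolSign (ω i) : ℂ) * (cp * ((boolSign (ω j) : ℂ) * f j))) =
        if i = j then f j else 0 := by
    intro j
    have h := congrArg (fun t : ℝ => (t : ℂ)) (sum_boolSign_mul_boolSign i j)
    push_cast at h
    calc _ = (cp * cq : ℂ) * (∑ ω : Fin m → Bool, (boolSign (ω i) : ℂ) * boolSign (ω j)) * f j := by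
          rw [Finset.mul_sum, Finset.sum_mul]
          exact Finset.sum_congr rfl fun ω _ => by ring
      _ = _ := by
          rw [h]
          split_ifs
          · have h' := congrArg (fun t : ℝ => (t : ℂ)) hcpq
            push_cast [hN] at h' ⊢
            rw [h', one_mul]
          · simp
  simp [this]

end Complementation

/-! ### ℓ^p as an ℓ^p-sum of copies of itself -/

section Blocks

variable (p : ℝ≥0∞) [Fact (1 ≤ p)]

/-- Restriction of a sequence to the subsequence indexed by the `n`-th row of `ℕ × ℕ ≃ ℕ`. -/
def lpRow (hp : p ≠ ∞) (n : ℕ) : lp (fun _ : ℕ => ℂ) p →L[ℂ] lp (fun _ : ℕ => ℂ) p :=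
  have hp0 : 0 < p.toReal :=
    ENNReal.toReal_pos (zero_lt_one.trans_le (Fact.out : 1 ≤ p)).ne' hp
  have hinj : Function.Injective (Nat.pair n) := fun i j h => (Nat.pair_eq_pair.1 h).2
  have hb (f : lp (fun _ : ℕ => ℂ) p) (s : Finset ℕ) :
      ∑ j ∈ s, ‖f (Nat.pair n j)‖ ^ p.toReal ≤ ‖f‖ ^ p.toReal := by
    simpa [Finset.sum_map] using lp.sum_rpow_le_norm_rpow hp0 f (s.map ⟨Nat.pair n, hinj⟩)
  LinearMap.mkContinuous
    { toFun f := ⟨fun j => f (Nat.pair n j), memℓp_gen' (hb f)⟩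
      map_add' _ _ := by ext; rfl
      map_smul' _ _ := by ext; rfl } 1
    fun f => by
      rw [one_mul]
      exact lp.norm_le_of_forall_sum_le hp0 (norm_nonneg _) (hb f)

/-- The embedding of `ℓ^p` as the sequences supported in the `n`-th row of `ℕ × ℕ ≃ ℕ`. -/
def lpRowEmbedding (hp : p ≠ ∞) (n : ℕ) : lp (fun _ : ℕ => ℂ) p →L[ℂ] lp (fun _ : ℕ => ℂ) p :=
  have hp0 : 0 < p.toReal :=
    ENNReal.toReal_pos (zero_lt_one.trans_le (Fact.out : 1 ≤ p)).ne' hp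
  have hinj : Function.Injective (Nat.pair n) := fun i j h => (Nat.pair_eq_pair.1 h).2
  have hs (f : lp (fun _ : ℕ => ℂ) p) :
      HasSum (fun k => ‖Function.extend (Nat.pair n) f 0 k‖ ^ p.toReal) (‖f‖ ^ p.toReal) := by
    have h : (fun k => ‖Function.extend (Nat.pair n) f 0 k‖ ^ p.toReal) =
        Function.extend (Nat.pair n) (fun j => ‖f j‖ ^ p.toReal) 0 := by
      funext k
      by_cases hk : ∃ j, Nat.pair n j = k
      · obtain ⟨j, rfl⟩ := hk
        simp [hinj.extend_apply]
      · simp [Function.extend_apply' _ _ _ hk, Real.zero_rpow hp0.ne']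
    rw [h, hasSum_extend_zero hinj]
    exact lp.hasSum_norm hp0 f
  LinearMap.mkContinuous
    { toFun f := ⟨Function.extend (Nat.pair n) f 0, memℓp_gen (hs f).summable⟩
      map_add' f g := by
        ext k
        change Function.extend (Nat.pair n) (fun j => f j + g j) 0 k =
          Function.extend (Nat.pair n) f 0 k + Function.extend (Nat.pair n) g 0 k
        by_cases hk : ∃ j, Nat.pair n j = k
        · obtain ⟨j, rfl⟩ := hk
          simp [hinj.extend_apply]
        · simp [Function.extend_apply' _ _ _ hk]
      map_smul' c f := by
        ext k
        by_cases hk : ∃ j, Nat.pair n j = k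
        · obtain ⟨j, rfl⟩ := hk
          simp [hinj.extend_apply]
        · simp [Function.extend_apply' _ _ _ hk] } 1
    fun f => by
      rw [one_mul]
      exact lp.norm_le_of_tsum_le hp0 (norm_nonneg _) (hs f).tsum_eq.le

variable {p}

theorem norm_lpRow_le (hp : p ≠ ∞) (n : ℕ) : ‖lpRow p hp n‖ ≤ 1 := by
  unfold lpRow
  exact LinearMap.mkContinuous_norm_le _ zero_le_one _

theorem norm_lpRowEmbedding_le (hp : p ≠ ∞) (n : ℕ) : ‖lpRowEmbedding p hp n‖ ≤ 1 := by
  unfold lpRowEmbedding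
  exact LinearMap.mkContinuous_norm_le _ zero_le_one _

theorem lpRow_apply (hp : p ≠ ∞) (n : ℕ) (f : lp (fun _ : ℕ => ℂ) p) (j : ℕ) :
    lpRow p hp n f j = f (Nat.pair n j) := rfl

theorem lpRowEmbedding_apply (hp : p ≠ ∞) (n : ℕ) (f : lp (fun _ : ℕ => ℂ) p) (m j : ℕ) :
    lpRowEmbedding p hp n f (Nat.pair m j) = if m = n then f j else 0 := by
  change Function.extend (Nat.pair n) f 0 (Nat.pair m j) = _
  have hinj : Function.Injective (Nat.pair n) := fun i j h => (Nat.pair_eq_pair.1 h).2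
  split_ifs with h
  · subst h
    exact hinj.extend_apply _ _ _
  · refine Function.extend_apply' _ _ _ ?_
    rintro ⟨i, hi⟩
    exact h (Nat.pair_eq_pair.1 hi).1.symm

theorem lpRow_lpRowEmbedding (hp : p ≠ ∞) (m n : ℕ) (f : lp (fun _ : ℕ => ℂ) p) :
    lpRow p hp m (lpRowEmbedding p hp n f) = if m = n then f else 0 := by
  ext j
  rw [lpRow_apply, lpRowEmbedding_apply]
  split_ifs <;> rfl

theorem hasSum_norm_lpRow (hp : p ≠ ∞) (f : lp (fun _ : ℕ => ℂ) p) :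
    HasSum (fun n => ‖lpRow p hp n f‖ ^ p.toReal) (‖f‖ ^ p.toReal) := by
  have hp0 : 0 < p.toReal :=
    ENNReal.toReal_pos (zero_lt_one.trans_le (Fact.out : 1 ≤ p)).ne' hp
  have h := Nat.pairEquiv.hasSum_iff.2 (lp.hasSum_norm hp0 f)
  exact h.prod_fiberwise fun n => lp.hasSum_norm hp0 (lpRow p hp n f)

/-- Every bounded sequence of operators on `ℓ^p` is realised by a block diagonal operator. -/
theorem exists_blockDiagonal (hp : p ≠ ∞)
    (c : ℕ → lp (fun _ : ℕ => ℂ) p →L[ℂ] lp (fun _ : ℕ => ℂ) p) {M : ℝ} (hc : ∀ n, ‖c n‖ ≤ M) :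
    ∃ b : lp (fun _ : ℕ => ℂ) p →L[ℂ] lp (fun _ : ℕ => ℂ) p, ∀ n,
      (lpRow p hp n).comp b = (c n).comp (lpRow p hp n) ∧
      b.comp (lpRowEmbedding p hp n) = (lpRowEmbedding p hp n).comp (c n) := by
  have hp0 : 0 < p.toReal :=
    ENNReal.toReal_pos (zero_lt_one.trans_le (Fact.out : 1 ≤ p)).ne' hp
  have hM : 0 ≤ M := (norm_nonneg _).trans (hc 0)
  have hb (f : lp (fun _ : ℕ => ℂ) p) (s : Finset ℕ) :
      ∑ k ∈ s, ‖c (Nat.unpair k).1 (lpRow p hp (Nat.unpair k).1 f) (Nat.unpair k).2‖ ^ p.toReal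
        ≤ (M * ‖f‖) ^ p.toReal := by
    set g : ℕ × ℕ → ℝ := fun x => ‖c x.1 (lpRow p hp x.1 f) x.2‖ ^ p.toReal with hg
    set t := s.map Nat.pairEquiv.symm.toEmbedding with ht
    -- Enlarging the finite index set to a rectangle allows summation row by row.
    have hsub : t ⊆ t.image Prod.fst ×ˢ t.image Prod.snd := fun x hx =>
      Finset.mem_product.2 ⟨Finset.mem_image_of_mem _ hx, Finset.mem_image_of_mem _ hx⟩
    calc _ = ∑ x ∈ t, g x := by rw [ht, Finset.sum_map]; rfl
      _ ≤ ∑ x ∈ t.image Prod.fst ×ˢ t.image Prod.snd, g x :=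
          Finset.sum_le_sum_of_subset_of_nonneg hsub fun _ _ _ => by positivity
      _ = ∑ n ∈ t.image Prod.fst, ∑ j ∈ t.image Prod.snd, g (n, j) := Finset.sum_product _ _ _
      _ ≤ ∑ n ∈ t.image Prod.fst, M ^ p.toReal * ‖lpRow p hp n f‖ ^ p.toReal := by
          refine Finset.sum_le_sum fun n _ => ?_
          refine (lp.sum_rpow_le_norm_rpow hp0 (c n (lpRow p hp n f)) _).trans ?_
          rw [← Real.mul_rpow hM (norm_nonneg _)]
          exact Real.rpow_le_rpow (norm_nonneg _) ((c n).le_of_opNorm_le (hc n) _) hp0.le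
      _ ≤ M ^ p.toReal * ‖f‖ ^ p.toReal := by
          rw [← Finset.mul_sum]
          gcongr
          exact sum_le_hasSum _ (fun _ _ => by positivity) (hasSum_norm_lpRow hp f)
      _ = _ := (Real.mul_rpow hM (norm_nonneg _)).symm
  refine ⟨LinearMap.mkContinuous
    { toFun f := ⟨fun k => c (Nat.unpair k).1 (lpRow p hp (Nat.unpair k).1 f) (Nat.unpair k).2,
        memℓp_gen' (hb f)⟩
      map_add' _ _ := by ext; simp; rfl
      map_smul' _ _ := by ext; simp } M fun f =>
        lp.norm_le_of_forall_sum_le hp0 (by positivity) (hb f), fun n => ⟨?_, ?_⟩⟩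
  · ext f j
    change c (Nat.unpair (Nat.pair n j)).1 (lpRow p hp (Nat.unpair (Nat.pair n j)).1 f)
      (Nat.unpair (Nat.pair n j)).2 = _
    rw [Nat.unpair_pair]
    rfl
  · ext f k
    obtain ⟨⟨m, j⟩, rfl⟩ := Nat.pairEquiv.surjective k
    change c (Nat.unpair (Nat.pair m j)).1 (lpRow p hp (Nat.unpair (Nat.pair m j)).1
      (lpRowEmbedding p hp n f)) (Nat.unpair (Nat.pair m j)).2 =
        lpRowEmbedding p hp n (c n f) (Nat.pair m j)
    rw [Nat.unpair_pair, lpRowEmbedding_apply, lpRow_lpRowEmbedding]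
    dsimp only
    split_ifs with h
    · rw [h]
    · rw [map_zero]; rfl

end Blocks

/-! ### Operators and commutators on the algebraic tensor square -/

section TensorSquare

variable {A B D : Type*} [NonUnitalNormedRing A] [NormedSpace ℂ A] [NonUnitalNormedRing B]
  [NormedSpace ℂ B] [NonUnitalNormedRing D] [NormedSpace ℂ D]

/-- The operator `S ⊗ T` on the algebraic tensor square. -/
def tensorSquareMap (S T : A →L[ℂ] B) : (⨂[ℂ] _ : Fin 2, A) →L[ℂ] (⨂[ℂ] _ : Fin 2, B) :=
  PiTensorProduct.mapL (𝕜 := ℂ) (E := fun _ : Fin 2 => A) (E' := fun _ : Fin 2 => B)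
    (![S, T] : Fin 2 → (A →L[ℂ] B))

theorem tensorSquareMap_tprod (S T : A →L[ℂ] B) (m : Fin 2 → A) :
    tensorSquareMap S T (PiTensorProduct.tprod ℂ m) =
      PiTensorProduct.tprod ℂ (![S (m 0), T (m 1)] : Fin 2 → B) := by
  simp only [tensorSquareMap, PiTensorProduct.mapL_apply, PiTensorProduct.map_tprod]
  congr 1
  funext i
  fin_cases i <;> rfl

theorem tensorSquare_clm_ext {F : Type*} [AddCommGroup F] [Module ℂ F] [TopologicalSpace F]
    {f g : (⨂[ℂ] _ : Fin 2, A) →L[ℂ] F}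
    (h : ∀ m : Fin 2 → A, f (PiTensorProduct.tprod ℂ m) = g (PiTensorProduct.tprod ℂ m)) :
    f = g := by
  apply ContinuousLinearMap.coe_injective
  ext m
  exact h m

theorem tensorSquareMap_comp (S' T' : B →L[ℂ] D) (S T : A →L[ℂ] B) :
    (tensorSquareMap S' T').comp (tensorSquareMap S T) =
      tensorSquareMap (S'.comp S) (T'.comp T) :=
  tensorSquare_clm_ext fun m => by
    simp only [ContinuousLinearMap.comp_apply, tensorSquareMap_tprod]
    rfl

theorem norm_tensorSquareMap_le (S T : A →L[ℂ] B) : ‖tensorSquareMap S T‖ ≤ ‖S‖ * ‖T‖ := by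
  refine (PiTensorProduct.opNorm_mapL _).trans_eq ?_
  simp [Fin.prod_univ_two]

theorem tensorSquareMap_sub_left (S S' T : A →L[ℂ] B) :
    tensorSquareMap (S - S') T = tensorSquareMap S T - tensorSquareMap S' T :=
  tensorSquare_clm_ext fun m => by
    have h := (PiTensorProduct.tprod ℂ (s := fun _ : Fin 2 => B)).map_update_sub
      ![0, T (m 1)] 0 (S (m 0)) (S' (m 0))
    simp only [sub_apply, tensorSquareMap_tprod]
    convert h using 3 <;> · funext i; fin_cases i <;> rfl

theorem tensorSquareMap_sub_right (S T T' : A →L[ℂ] B) :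
    tensorSquareMap S (T - T') = tensorSquareMap S T - tensorSquareMap S T' :=
  tensorSquare_clm_ext fun m => by
    have h := (PiTensorProduct.tprod ℂ (s := fun _ : Fin 2 => B)).map_update_sub
      ![S (m 0), 0] 1 (T (m 1)) (T' (m 1))
    simp only [sub_apply, tensorSquareMap_tprod]
    convert h using 3 <;> · funext i; fin_cases i <;> rfl

theorem ProjTensorSquare.map_coe (S T : A →L[ℂ] A) (t : ⨂[ℂ] _ : Fin 2, A) :
    ProjTensorSquare.map S T (t : ProjTensorSquare A) = (tensorSquareMap S T t : ProjTensorSquare A) :=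
  ProjTensorSquare.extend_coe _ _

variable [IsScalarTower ℂ A A] [SMulCommClass ℂ A A]

variable (A) in
/-- The multiplication on the algebraic tensor square. -/
def tensorSquareMul : (⨂[ℂ] _ : Fin 2, A) →L[ℂ] A :=
  PiTensorProduct.liftIsometry ℂ (fun _ : Fin 2 => A) A (mulMultilinear A)

theorem tensorSquareMul_tprod (m : Fin 2 → A) :
    tensorSquareMul A (PiTensorProduct.tprod ℂ m) = m 0 * m 1 := by
  rw [tensorSquareMul, PiTensorProduct.liftIsometry_apply_apply, PiTensorProduct.lift.tprod]
  rfl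

theorem ProjTensorSquare.diag_coe [CompleteSpace A] (t : ⨂[ℂ] _ : Fin 2, A) :
    ProjTensorSquare.diag A (t : ProjTensorSquare A) = tensorSquareMul A t :=
  ProjTensorSquare.extend_coe _ _

/-- The algebraic version of `a · t - t · a`. -/
def tensorSquareComm (a : A) : (⨂[ℂ] _ : Fin 2, A) →L[ℂ] (⨂[ℂ] _ : Fin 2, A) :=
  tensorSquareMap (ContinuousLinearMap.mul ℂ A a) (ContinuousLinearMap.id ℂ A) -
    tensorSquareMap (ContinuousLinearMap.id ℂ A) ((ContinuousLinearMap.mul ℂ A).flip a)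

theorem leftAct_sub_rightAct_coe (a : A) (t : ⨂[ℂ] _ : Fin 2, A) :
    ProjTensorSquare.leftAct a (t : ProjTensorSquare A) -
      ProjTensorSquare.rightAct a (t : ProjTensorSquare A) =
        (tensorSquareComm a t : ProjTensorSquare A) := by
  rw [ProjTensorSquare.leftAct, ProjTensorSquare.rightAct, ProjTensorSquare.map_coe,
    ProjTensorSquare.map_coe, ← UniformSpace.Completion.coe_sub]
  rfl

theorem tensorSquareComm_sub (a b : A) :
    tensorSquareComm (a - b) = tensorSquareComm a - tensorSquareComm b := by
  simp only [tensorSquareComm, map_sub, tensorSquareMap_sub_left, tensorSquareMap_sub_right]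
  abel

theorem norm_tensorSquareComm_le (a : A) : ‖tensorSquareComm a‖ ≤ 2 * ‖a‖ := by
  have hid := ContinuousLinearMap.norm_id_le (𝕜 := ℂ) (E := A)
  have h1 := norm_tensorSquareMap_le (ContinuousLinearMap.mul ℂ A a) (ContinuousLinearMap.id ℂ A)
  have h2 := norm_tensorSquareMap_le (ContinuousLinearMap.id ℂ A)
    ((ContinuousLinearMap.mul ℂ A).flip a)
  have h3 := ContinuousLinearMap.opNorm_mul_apply_le ℂ A a
  have h4 : ‖(ContinuousLinearMap.mul ℂ A).flip a‖ ≤ ‖a‖ :=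
    ContinuousLinearMap.opNorm_le_bound _ (norm_nonneg a) fun x => by
      rw [mul_comm ‖a‖]; exact norm_mul_le x a
  have h5 : ‖ContinuousLinearMap.mul ℂ A a‖ * ‖ContinuousLinearMap.id ℂ A‖ ≤ ‖a‖ * 1 := by gcongr
  have h6 : ‖ContinuousLinearMap.id ℂ A‖ * ‖(ContinuousLinearMap.mul ℂ A).flip a‖ ≤ 1 * ‖a‖ := by
    gcongr
  calc ‖tensorSquareComm a‖ ≤ _ := norm_sub_le
        (tensorSquareMap (ContinuousLinearMap.mul ℂ A a) (ContinuousLinearMap.id ℂ A)) _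
    _ ≤ _ := by linarith

variable [IsScalarTower ℂ B B] [SMulCommClass ℂ B B]

/-- The left action touches only the first factor and the right action only the second, so each of
`S` and `T` has to intertwine on one side only. -/
theorem tensorSquareComm_map {S T : A →L[ℂ] B} {a : A} {b : B} (hS : ∀ x, b * S x = S (a * x))
    (hT : ∀ x, T x * b = T (x * a)) (t : ⨂[ℂ] _ : Fin 2, A) :
    tensorSquareComm b (tensorSquareMap S T t) = tensorSquareMap S T (tensorSquareComm a t) := by
  have h1 : (ContinuousLinearMap.mul ℂ B b).comp S = S.comp (ContinuousLinearMap.mul ℂ A a) :=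
    ContinuousLinearMap.ext hS
  have h2 : ((ContinuousLinearMap.mul ℂ B).flip b).comp T =
      T.comp ((ContinuousLinearMap.mul ℂ A).flip a) := ContinuousLinearMap.ext hT
  have h3 : (tensorSquareComm b).comp (tensorSquareMap S T) =
      (tensorSquareMap S T).comp (tensorSquareComm a) := by
    simp only [tensorSquareComm, ContinuousLinearMap.sub_comp, ContinuousLinearMap.comp_sub,
      tensorSquareMap_comp, h1, h2, ContinuousLinearMap.id_comp, ContinuousLinearMap.comp_id]
  exact DFunLike.congr_fun h3 t

end TensorSquare

/-! ### Amenability tested on algebraic tensors -/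

section ApproximateDiagonals

universe u

variable {A : Type u} [NonUnitalNormedRing A] [NormedSpace ℂ A] [IsScalarTower ℂ A A]
  [SMulCommClass ℂ A A] [CompleteSpace A]

/-- An amenable Banach algebra has approximate diagonals in the algebraic tensor square. -/
theorem IsAmenableBanachAlgebra.exists_algebraic (h : IsAmenableBanachAlgebra A) :
    ∃ C : ℝ, ∀ (F : Finset A) (ε : ℝ), 0 < ε → ∃ t : ⨂[ℂ] _ : Fin 2, A, ‖t‖ ≤ C ∧
      ∀ a ∈ F, ‖tensorSquareComm a t‖ ≤ ε ∧ ‖a * tensorSquareMul A t - a‖ ≤ ε := by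
  obtain ⟨ι, _, _, _, d, ⟨C, hC⟩, hcomm, hmul⟩ := h
  -- The slack in the bound makes all conditions open, so a point of the dense algebraic tensor
  -- square can satisfy them.
  refine ⟨C + 1, fun F ε hε => ?_⟩
  have h1 : ∀ᶠ α in atTop, ∀ a ∈ F,
      ‖ProjTensorSquare.leftAct a (d α) - ProjTensorSquare.rightAct a (d α)‖ < ε ∧
      ‖a * ProjTensorSquare.diag A (d α) - a‖ < ε := by
    rw [eventually_all_finset]
    intro a _
    have e1 := (hcomm a).norm
    have e2 := ((hmul a).sub_const a).norm
    rw [norm_zero] at e1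
    rw [sub_self, norm_zero] at e2
    exact (e1.eventually_lt_const hε).and (e2.eventually_lt_const hε)
  obtain ⟨α, hα⟩ := h1.exists
  let O : Set (ProjTensorSquare A) := {x | ‖x‖ < C + 1} ∩ ⋂ a ∈ F,
    {x | ‖ProjTensorSquare.leftAct a x - ProjTensorSquare.rightAct a x‖ < ε ∧
      ‖a * ProjTensorSquare.diag A x - a‖ < ε}
  have hO : IsOpen O := by
    refine (isOpen_lt continuous_norm continuous_const).inter ?_
    refine isOpen_biInter_finset fun a _ => ?_
    have c1 : Continuous fun x : ProjTensorSquare A =>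
        ‖ProjTensorSquare.leftAct a x - ProjTensorSquare.rightAct a x‖ := by fun_prop
    have c2 : Continuous fun x : ProjTensorSquare A =>
        ‖a * ProjTensorSquare.diag A x - a‖ := by fun_prop
    exact (isOpen_lt c1 continuous_const).inter (isOpen_lt c2 continuous_const)
  have hdense : DenseRange ((↑) : (⨂[ℂ] _ : Fin 2, A) → ProjTensorSquare A) :=
    UniformSpace.Completion.denseRange_coe
  obtain ⟨t, ht1, ht2⟩ := hdense.exists_mem_open hO
    ⟨d α, by simpa using (hC α).trans_lt (lt_add_one C), Set.mem_iInter₂.2 hα⟩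
  refine ⟨t, ?_, fun a ha => ?_⟩
  · have : ‖(t : ProjTensorSquare A)‖ < C + 1 := ht1
    rw [UniformSpace.Completion.norm_coe] at this
    exact this.le
  · obtain ⟨h1, h2⟩ := Set.mem_iInter₂.1 ht2 a ha
    rw [leftAct_sub_rightAct_coe, UniformSpace.Completion.norm_coe] at h1
    rw [ProjTensorSquare.diag_coe] at h2
    exact ⟨h1.le, h2.le⟩

/-- A criterion for amenability by algebraic tensors, allowing perturbation of the elements to be
tested. -/
theorem isAmenableBanachAlgebra_of_approx {C : ℝ} (h : ∀ (F : Finset A) (ε : ℝ), 0 < ε →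
    ∃ t : ⨂[ℂ] _ : Fin 2, A, ‖t‖ ≤ C ∧ ∀ a ∈ F, ∃ a' : A, ‖a - a'‖ ≤ ε ∧
      ‖tensorSquareComm a' t‖ ≤ ε ∧ ‖a' * tensorSquareMul A t - a'‖ ≤ ε) :
    IsAmenableBanachAlgebra A := by
  classical
  have hC : 0 ≤ C := by
    obtain ⟨t, ht, -⟩ := h ∅ 1 one_pos
    exact (norm_nonneg _).trans ht
  set δ := ‖tensorSquareMul A‖ with hδ
  have hδ0 : 0 ≤ δ := norm_nonneg (tensorSquareMul A)
  -- For an error η, replacing `a'` by `a` costs at most η(2C + 1) in the commutator and η(δC + 2)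
  -- in the product; `M` dominates both factors.
  set M : ℝ := 2 * C + δ * C + 2 with hM
  have hM0 : 0 < M := by positivity
  choose! t ht1 ht2 using h
  have hpos : ∀ n : ℕ, 0 < 1 / ((n : ℝ) + 1) / M := fun n => by positivity
  have key : ∀ (F : Finset A) (n : ℕ), ∀ a ∈ F,
      ‖tensorSquareComm a (t F (1 / ((n : ℝ) + 1) / M))‖ ≤ 1 / ((n : ℝ) + 1) ∧
      ‖a * tensorSquareMul A (t F (1 / ((n : ℝ) + 1) / M)) - a‖ ≤ 1 / ((n : ℝ) + 1) := by
    intro F n a ha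
    set η : ℝ := 1 / ((n : ℝ) + 1) / M with hη
    have hη0 : 0 < η := hpos n
    have hηM : 1 / ((n : ℝ) + 1) = η * M := by rw [hη]; field_simp
    obtain ⟨a', h1, h2, h3⟩ := ht2 F η hη0 a ha
    have htC := ht1 F η hη0
    rw [hηM]
    constructor
    · have heq : tensorSquareComm a (t F η) =
          tensorSquareComm (a - a') (t F η) + tensorSquareComm a' (t F η) := by
        rw [tensorSquareComm_sub]; simp
      rw [heq]
      have h4 : ‖tensorSquareComm (a - a') (t F η)‖ ≤ 2 * η * C :=
        (tensorSquareComm (a - a')).le_of_opNorm_le_of_le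
          ((norm_tensorSquareComm_le _).trans (by linarith)) htC
      refine (norm_add_le _ _).trans ?_
      nlinarith [mul_nonneg hδ0 hC]
    · have heq : a * tensorSquareMul A (t F η) - a = (a - a') * tensorSquareMul A (t F η) +
          (a' * tensorSquareMul A (t F η) - a') - (a - a') := by
        rw [sub_mul]; abel
      rw [heq]
      have h4 : ‖tensorSquareMul A (t F η)‖ ≤ δ * C :=
        (tensorSquareMul A).le_of_opNorm_le_of_le le_rfl htC
      have h5 : ‖(a - a') * tensorSquareMul A (t F η)‖ ≤ η * (δ * C) :=
        (norm_mul_le _ _).trans (mul_le_mul h1 h4 (norm_nonneg _) hη0.le)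
      refine (norm_sub_le _ _).trans ((add_le_add (norm_add_le _ _) le_rfl).trans ?_)
      nlinarith [mul_nonneg hδ0 hC]
  have hlim : Tendsto (fun α : Finset A × ℕ => 1 / ((α.2 : ℝ) + 1)) atTop (𝓝 0) := by
    rw [← prod_atTop_atTop_eq]
    exact tendsto_one_div_add_atTop_nhds_zero_nat.comp tendsto_snd
  have hmem : ∀ a : A, ∀ᶠ α : Finset A × ℕ in atTop, a ∈ α.1 := fun a => by
    filter_upwards [eventually_ge_atTop ({a}, 0)] with α hα
    exact hα.1 (Finset.mem_singleton_self a)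
  refine ⟨Finset A × ℕ, inferInstance, inferInstance, inferInstance,
    fun α => (t α.1 (1 / ((α.2 : ℝ) + 1) / M) : ProjTensorSquare A), ⟨C, fun α => ?_⟩,
    fun a => ?_, fun a => ?_⟩
  · rw [UniformSpace.Completion.norm_coe]
    exact ht1 _ _ (hpos _)
  · refine squeeze_zero_norm' ?_ hlim
    filter_upwards [hmem a] with α hα
    rw [leftAct_sub_rightAct_coe, UniformSpace.Completion.norm_coe]
    exact (key α.1 α.2 a hα).1
  · rw [tendsto_iff_norm_sub_tendsto_zero]
    refine squeeze_zero' (Eventually.of_forall fun _ => norm_nonneg _) ?_ hlim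
    filter_upwards [hmem a] with α hα
    rw [ProjTensorSquare.diag_coe]
    exact (key α.1 α.2 a hα).2

/-- Amenability passes from `A` to `B` if approximate diagonals of `A` can be compressed to `B`. -/
theorem IsAmenableBanachAlgebra.of_compressions {B : Type*} [NonUnitalNormedRing B]
    [NormedSpace ℂ B] [IsScalarTower ℂ B B] [SMulCommClass ℂ B B] [CompleteSpace B]
    (hA : IsAmenableBanachAlgebra A) {K L : ℝ} (hL : 0 ≤ L)
    (h : ∀ (F : Finset B) (ε : ℝ), 0 < ε → ∃ (a' : B → B) (b : B → A) (S T : A →L[ℂ] B),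
      ‖S‖ ≤ K ∧ ‖T‖ ≤ K ∧ ∀ a ∈ F, ‖a - a' a‖ ≤ ε ∧ (∀ x, a' a * S x = S (b a * x)) ∧
        (∀ x, T x * a' a = T (x * b a)) ∧ ∀ t : ⨂[ℂ] _ : Fin 2, A,
          ‖a' a * tensorSquareMul B (tensorSquareMap S T t) - a' a‖ ≤
            L * ‖b a * tensorSquareMul A t - b a‖) :
    IsAmenableBanachAlgebra B := by
  classical
  obtain ⟨C, hC⟩ := hA.exists_algebraic
  refine isAmenableBanachAlgebra_of_approx (C := K * K * C) fun F ε hε => ?_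
  obtain ⟨a', b, S, T, hS, hT, hST⟩ := h F ε hε
  have hK : 0 ≤ K := (norm_nonneg S).trans hS
  -- The tolerance absorbs both loss factors, `K * K` for commutators and `L` for products; the 1
  -- keeps the denominator positive.
  obtain ⟨t, htC, ht⟩ := hC (F.image b) (ε / (K * K + L + 1)) (by positivity)
  have hK' : K * K * (ε / (K * K + L + 1)) ≤ ε := by
    rw [mul_div_assoc', div_le_iff₀ (by positivity)]
    nlinarith
  have hL' : L * (ε / (K * K + L + 1)) ≤ ε := by
    rw [mul_div_assoc', div_le_iff₀ (by positivity)]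
    nlinarith [mul_nonneg hK hK]
  have hn : ‖tensorSquareMap S T‖ ≤ K * K :=
    (norm_tensorSquareMap_le S T).trans (mul_le_mul hS hT (norm_nonneg T) hK)
  refine ⟨tensorSquareMap S T t, (tensorSquareMap S T).le_of_opNorm_le_of_le hn htC,
    fun a ha => ?_⟩
  obtain ⟨h1, h2, h3, h4⟩ := hST a ha
  obtain ⟨h5, h6⟩ := ht _ (Finset.mem_image_of_mem b ha)
  refine ⟨a' a, h1, ?_, ?_⟩
  · rw [tensorSquareComm_map h2 h3]
    exact ((tensorSquareMap S T).le_of_opNorm_le_of_le hn h5).trans hK'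
  · exact (h4 t).trans ((mul_le_mul_of_nonneg_left h6 hL).trans hL')

end ApproximateDiagonals

/-! ### Transfer from B(X) to ℓ^∞(K(E)) -/

section Transfer

/-- A bounded sequence of operators `A → B`, as an operator `A → ℓ^∞(B)`. -/
def ellInftyPi {A B : Type*} [NormedAddCommGroup A] [NormedSpace ℂ A] [NonUnitalNormedRing B]
    [NormedSpace ℂ B] (φ : ℕ → A →L[ℂ] B) {K : ℝ} (hφ : ∀ n, ‖φ n‖ ≤ K) : A →L[ℂ] EllInfty B :=
  LinearMap.mkContinuous
    { toFun x := ⟨fun n => φ n x, memℓp_infty ⟨K * ‖x‖, by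
        rintro _ ⟨n, rfl⟩
        exact (φ n).le_of_opNorm_le (hφ n) x⟩⟩
      map_add' _ _ := by ext n; exact map_add (φ n) _ _
      map_smul' _ _ := by ext n; exact map_smul (φ n) _ _ } K
    fun x => lp.norm_le_of_forall_le
      (mul_nonneg ((norm_nonneg _).trans (hφ 0)) (norm_nonneg x))
      fun n => (φ n).le_of_opNorm_le (hφ n) x

theorem norm_ellInftyPi_le {A B : Type*} [NormedAddCommGroup A] [NormedSpace ℂ A]
    [NonUnitalNormedRing B] [NormedSpace ℂ B] (φ : ℕ → A →L[ℂ] B) {K : ℝ}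
    (hφ : ∀ n, ‖φ n‖ ≤ K) : ‖ellInftyPi φ hφ‖ ≤ K := by
  unfold ellInftyPi
  exact LinearMap.mkContinuous_norm_le _ ((norm_nonneg _).trans (hφ 0)) _

variable {X E : Type*} [NormedAddCommGroup X] [NormedSpace ℂ X] [NormedAddCommGroup E]
  [NormedSpace ℂ E]

/-- The operator `x ↦ L x R` from `B(X)` to `K(E)`, where all the operators `L x R` are compact. -/
def compactSandwich (L : X →L[ℂ] E) (R : E →L[ℂ] X)
    (h : ∀ x : X →L[ℂ] X, IsCompactOperator (L.comp (x.comp R))) :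
    (X →L[ℂ] X) →L[ℂ] CompactOperators E :=
  LinearMap.mkContinuous
    { toFun x := ⟨L.comp (x.comp R), h x⟩
      map_add' x y := Subtype.ext (by simp [ContinuousLinearMap.add_comp]; rfl)
      map_smul' c x := Subtype.ext (by simp [ContinuousLinearMap.smul_comp]; rfl) } (‖L‖ * ‖R‖)
    fun x => by
      change ‖L.comp (x.comp R)‖ ≤ _
      calc ‖L.comp (x.comp R)‖ ≤ ‖L‖ * (‖x‖ * ‖R‖) :=
            (L.opNorm_comp_le _).trans (by gcongr; exact x.opNorm_comp_le _)
        _ = _ := by ring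

theorem norm_compactSandwich_le (L : X →L[ℂ] E) (R : E →L[ℂ] X)
    (h : ∀ x : X →L[ℂ] X, IsCompactOperator (L.comp (x.comp R))) :
    ‖compactSandwich L R h‖ ≤ ‖L‖ * ‖R‖ := by
  unfold compactSandwich
  exact LinearMap.mkContinuous_norm_le _ (by positivity) _

theorem tensorSquareMul_ellInftyPi_apply {A B : Type*} [NonUnitalNormedRing A] [NormedSpace ℂ A]
    [NonUnitalNormedRing B] [NormedSpace ℂ B] [IsScalarTower ℂ B B] [SMulCommClass ℂ B B]
    {φ ψ : ℕ → A →L[ℂ] B} {K : ℝ} (hφ : ∀ n, ‖φ n‖ ≤ K) (hψ : ∀ n, ‖ψ n‖ ≤ K)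
    (t : ⨂[ℂ] _ : Fin 2, A) (n : ℕ) :
    tensorSquareMul (EllInfty B) (tensorSquareMap (ellInftyPi φ hφ) (ellInftyPi ψ hψ) t) n =
      tensorSquareMul B (tensorSquareMap (φ n) (ψ n) t) := by
  have h : (lp.evalCLM ℂ (fun _ : ℕ => B) ∞ n).comp ((tensorSquareMul (EllInfty B)).comp
      (tensorSquareMap (ellInftyPi φ hφ) (ellInftyPi ψ hψ))) =
      (tensorSquareMul B).comp (tensorSquareMap (φ n) (ψ n)) := by
    refine tensorSquare_clm_ext fun x => ?_
    simp only [ContinuousLinearMap.comp_apply, tensorSquareMap_tprod, tensorSquareMul_tprod]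
    rfl
  exact DFunLike.congr_fun h t

variable (E) in
/-- The inclusion of `K(E)` in `B(E)`. -/
def compactOperatorsInclusion : CompactOperators E →L[ℂ] (E →L[ℂ] E) :=
  LinearMap.mkContinuous
    { toFun T := T.1
      map_add' _ _ := rfl
      map_smul' _ _ := rfl } 1 fun T => (one_mul ‖T‖).ge

/-- On elementary tensors the product is L x e f y R, and e f = id collapses it to L (xy) R;
linearity and continuity do not see the failure of the two maps to be multiplicative. -/
theorem tensorSquareMul_compactSandwich {L : X →L[ℂ] E} {R : E →L[ℂ] X} {e : E →L[ℂ] X}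
    {f : X →L[ℂ] E} (hef : ∀ x, e (f x) = x)
    (h₁ : ∀ x : X →L[ℂ] X, IsCompactOperator (L.comp (x.comp e)))
    (h₂ : ∀ x : X →L[ℂ] X, IsCompactOperator (f.comp (x.comp R)))
    (t : ⨂[ℂ] _ : Fin 2, X →L[ℂ] X) :
    compactOperatorsInclusion E (tensorSquareMul (CompactOperators E) (tensorSquareMap
      (compactSandwich L e h₁) (compactSandwich f R h₂) t)) =
        L.comp ((tensorSquareMul (X →L[ℂ] X) t).comp R) := by
  have h : ((compactOperatorsInclusion E).comp (tensorSquareMul (CompactOperators E))).comp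
      (tensorSquareMap (compactSandwich L e h₁) (compactSandwich f R h₂)) =
      ((ContinuousLinearMap.compL ℂ E X E L).comp
        ((ContinuousLinearMap.compL ℂ E X X).flip R)).comp (tensorSquareMul (X →L[ℂ] X)) := by
    refine tensorSquare_clm_ext fun x => ?_
    simp only [ContinuousLinearMap.comp_apply, tensorSquareMap_tprod, tensorSquareMul_tprod]
    ext1 y
    change L (x 0 (e (f (x 1 (R y))))) = L (x 0 (x 1 (R y)))
    rw [hef]
  exact DFunLike.congr_fun h t

/-- Amenability passes from `B(X)` to `ℓ^∞(K(E))` if `X` contains uniformly complemented disjoint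
copies of itself and the finite-dimensional sections of `E` are uniformly complemented in `X`. -/
theorem isAmenable_ellInfty_compactOperators [CompleteSpace X] [CompleteSpace E]
    {K : ℝ} (V U : ℕ → X →L[ℂ] X) (hV : ∀ n, ‖V n‖ ≤ 1) (hU : ∀ n, ‖U n‖ ≤ 1)
    (hVU : ∀ n x, V n (U n x) = x)
    (hblock : ∀ (c : ℕ → X →L[ℂ] X) (M : ℝ), (∀ n, ‖c n‖ ≤ M) → ∃ b : X →L[ℂ] X, ∀ n,
      (V n).comp b = (c n).comp (V n) ∧ b.comp (U n) = (U n).comp (c n))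
    (P : ℕ → E →L[ℂ] E) (J : ℕ → E →L[ℂ] X) (Q : ℕ → X →L[ℂ] E)
    (hJ : ∀ m, ‖J m‖ ≤ K) (hQ : ∀ m, ‖Q m‖ ≤ K) (hQJ : ∀ m x, Q m (J m x) = P m x)
    (hPP : ∀ m x, P m (P m x) = P m x)
    (hJc : ∀ m, IsCompactOperator (J m)) (hQc : ∀ m, IsCompactOperator (Q m))
    (hP : ∀ T : E →L[ℂ] E, IsCompactOperator T →
      Tendsto (fun m => (P m).comp (T.comp (P m))) atTop (𝓝 T))
    (e : E →L[ℂ] X) (f : X →L[ℂ] E) (he : ‖e‖ ≤ K) (hf : ‖f‖ ≤ K) (hef : ∀ x, e (f x) = x)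
    (h : IsAmenableBanachAlgebra (X →L[ℂ] X)) :
    IsAmenableBanachAlgebra (EllInfty (CompactOperators E)) := by
  classical
  have hK : 0 ≤ K := (norm_nonneg _).trans (hJ 0)
  have hPn : ∀ m, ‖P m‖ ≤ K * K := fun m => by
    have : P m = (Q m).comp (J m) := by ext1 x; exact (hQJ m x).symm
    rw [this]
    exact ((Q m).opNorm_comp_le _).trans (mul_le_mul (hQ m) (hJ m) (norm_nonneg _) hK)
  refine h.of_compressions (K := K * K) (L := K * K) (by positivity) fun F ε hε => ?_
  -- finite-dimensional truncations of the elements of `F`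
  have hm : ∀ n, ∃ m, ∀ a ∈ F, ‖(P m).comp ((a n).1.comp (P m)) - (a n).1‖ ≤ ε := fun n => by
    have : ∀ᶠ m in atTop, ∀ a ∈ F, ‖(P m).comp ((a n).1.comp (P m)) - (a n).1‖ ≤ ε := by
      rw [eventually_all_finset]
      intro a _
      have := ((hP (a n).1 (a n).2).sub_const (a n).1).norm
      rw [sub_self, norm_zero] at this
      exact this.eventually_le_const hε
    exact this.exists
  choose m hm using hm
  have hcompact : ∀ (a : EllInfty (CompactOperators E)) n,
      IsCompactOperator ((P (m n)).comp ((a n).1.comp (P (m n)))) := fun a n =>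
    ((a n).2.comp_clm (P (m n))).clm_comp (P (m n))
  have hnorm : ∀ (a : EllInfty (CompactOperators E)) n,
      ‖(P (m n)).comp ((a n).1.comp (P (m n)))‖ ≤ (K * K) * (‖a‖ * (K * K)) := fun a n => by
    have h1 : ‖(a n).1‖ ≤ ‖a‖ := lp.norm_apply_le_norm (by simp) a n
    refine ((P (m n)).opNorm_comp_le _).trans (mul_le_mul (hPn _) ?_ (norm_nonneg _) (by positivity))
    exact ((a n).1.opNorm_comp_le _).trans (mul_le_mul h1 (hPn _) (norm_nonneg _) (norm_nonneg _))
  let cut : EllInfty (CompactOperators E) → EllInfty (CompactOperators E) := fun a =>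
    ⟨fun n => ⟨(P (m n)).comp ((a n).1.comp (P (m n))), hcompact a n⟩,
      memℓp_infty ⟨(K * K) * (‖a‖ * (K * K)), by rintro _ ⟨n, rfl⟩; exact hnorm a n⟩⟩
  have hcut : ∀ a n, (cut a n).1 = (P (m n)).comp ((a n).1.comp (P (m n))) := fun a n => rfl
  have hPcut : ∀ a n x, P (m n) ((cut a n).1 x) = (cut a n).1 x := fun a n x => by
    rw [hcut]; exact hPP _ _
  have hcutP : ∀ a n x, (cut a n).1 (P (m n) x) = (cut a n).1 x := fun a n x => by
    simp only [hcut, ContinuousLinearMap.comp_apply, hPP]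
  -- the corresponding block diagonal operators
  have hb : ∀ a : EllInfty (CompactOperators E), ∃ b : X →L[ℂ] X, ∀ n,
      (V n).comp b = ((J (m n)).comp ((cut a n).1.comp (Q (m n)))).comp (V n) ∧
      b.comp (U n) = (U n).comp ((J (m n)).comp ((cut a n).1.comp (Q (m n)))) := fun a => by
    refine hblock _ (K * (((K * K) * (‖a‖ * (K * K))) * K)) fun n => ?_
    refine ((J (m n)).opNorm_comp_le _).trans (mul_le_mul (hJ _) ?_ (norm_nonneg _) hK)
    exact ((cut a n).1.opNorm_comp_le _).trans
      (mul_le_mul (hnorm a n) (hQ _) (norm_nonneg _) (by positivity))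
  choose b hb using hb
  -- Here Q V b = Q J a' Q V = P a' Q V = a' Q V, the last because the truncated `a'` absorbs `P`.
  -- The next identity is its mirror image.
  have hVb : ∀ a n x, Q (m n) (V n (b a x)) = (cut a n).1 (Q (m n) (V n x)) := fun a n x => by
    have := DFunLike.congr_fun (hb a n).1 x
    simp only [ContinuousLinearMap.comp_apply] at this
    rw [this, hQJ, hPcut]
  have hbU : ∀ a n x, b a (U n (J (m n) x)) = U n (J (m n) ((cut a n).1 x)) := fun a n x => by
    have := DFunLike.congr_fun (hb a n).2 (J (m n) x)
    simp only [ContinuousLinearMap.comp_apply] at this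
    rw [this, hQJ, hcutP]
  have hL : ∀ n, IsCompactOperator ((Q (m n)).comp (V n)) := fun n => (hQc _).comp_clm (V n)
  have hR : ∀ n, IsCompactOperator ((U n).comp (J (m n))) := fun n => (hJc _).clm_comp (U n)
  have hLn : ∀ n, ‖(Q (m n)).comp (V n)‖ ≤ K := fun n =>
    ((Q (m n)).opNorm_comp_le _).trans
      ((mul_le_mul (hQ _) (hV n) (norm_nonneg _) hK).trans_eq (mul_one K))
  have hRn : ∀ n, ‖(U n).comp (J (m n))‖ ≤ K := fun n =>
    ((U n).opNorm_comp_le _).trans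
      ((mul_le_mul (hU n) (hJ _) (norm_nonneg _) zero_le_one).trans_eq (one_mul K))
  have hS : ∀ n, ‖compactSandwich ((Q (m n)).comp (V n)) e
      fun x => (hL n).comp_clm (x.comp e)‖ ≤ K * K := fun n =>
    (norm_compactSandwich_le _ _ _).trans (mul_le_mul (hLn n) he (norm_nonneg _) hK)
  have hT : ∀ n, ‖compactSandwich f ((U n).comp (J (m n)))
      fun x => ((hR n).clm_comp x).clm_comp f‖ ≤ K * K := fun n =>
    (norm_compactSandwich_le _ _ _).trans (mul_le_mul hf (hRn n) (norm_nonneg _) hK)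
  refine ⟨cut, b, ellInftyPi _ hS, ellInftyPi _ hT, norm_ellInftyPi_le _ hS,
    norm_ellInftyPi_le _ hT, fun a ha => ⟨lp.norm_le_of_forall_le hε.le fun n => ?_,
      fun x => ?_, fun x => ?_, fun t => lp.norm_le_of_forall_le (by positivity) fun n => ?_⟩⟩
  · exact (norm_sub_rev (a n).1 (cut a n).1).trans_le (hm n a ha)
  · refine lp.ext (funext fun n => Subtype.ext (ContinuousLinearMap.ext fun y => ?_))
    exact (hVb a n (x (e y))).symm
  · refine lp.ext (funext fun n => Subtype.ext (ContinuousLinearMap.ext fun y => ?_))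
    exact congrArg (fun z => f (x z)) (hbU a n y).symm
  · rw [lp.coeFn_sub, Pi.sub_apply, lp.infty_coeFn_mul, Pi.mul_apply,
      tensorSquareMul_ellInftyPi_apply]
    -- Pushing `cut a n` through Q V turns it into `b a`, while Q V b U J = `cut a n`; the error is
    -- thus a compression of the error at `b a`.
    have h1 : (cut a n).1.comp (((Q (m n)).comp (V n)).comp
          ((tensorSquareMul (X →L[ℂ] X) t).comp ((U n).comp (J (m n))))) - (cut a n).1 =
        ((Q (m n)).comp (V n)).comp
          ((b a * tensorSquareMul (X →L[ℂ] X) t - b a).comp ((U n).comp (J (m n)))) := by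
      ext1 y
      simp only [ContinuousLinearMap.comp_apply, sub_apply, map_sub,
        mul_apply_eq_comp, hVb, hVU, hQJ, hcutP]
    have h2 := tensorSquareMul_compactSandwich (L := (Q (m n)).comp (V n))
      (R := (U n).comp (J (m n))) hef
      (fun x => (hL n).comp_clm (x.comp e)) (fun x => ((hR n).clm_comp x).clm_comp f) t
    change ‖(cut a n).1.comp (compactOperatorsInclusion E _) - (cut a n).1‖ ≤ _
    refine (congrArg (fun z => ‖(cut a n).1.comp z - (cut a n).1‖) h2).trans_le ?_
    rw [h1]
    calc _ ≤ K * (‖b a * tensorSquareMul (X →L[ℂ] X) t - b a‖ * K) := by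
          refine (ContinuousLinearMap.opNorm_comp_le _ _).trans
            (mul_le_mul (hLn n) ?_ (norm_nonneg _) hK)
          exact (ContinuousLinearMap.opNorm_comp_le _ _).trans
            (mul_le_mul_of_nonneg_left (hRn n) (norm_nonneg _))
      _ = _ := by ring

end Transfer

/-! ### Finite sections of ℓ² ⊕ ℓ^p and the conclusion -/

section Main

variable {p : ℝ≥0∞} [Fact (1 ≤ p)]

/-- The projection of `ℓ^2 ⊕ ℓ^p` onto the first `m` coordinates of both summands. -/
def prodTrunc (p : ℝ≥0∞) [Fact (1 ≤ p)] (m : ℕ) :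
    lp (fun _ : ℕ => ℂ) 2 × lp (fun _ : ℕ => ℂ) p →L[ℂ]
      lp (fun _ : ℕ => ℂ) 2 × lp (fun _ : ℕ => ℂ) p :=
  (lpTrunc 2 m).prodMap (lpTrunc p m)

theorem prodTrunc_apply (m : ℕ) (x : lp (fun _ : ℕ => ℂ) 2 × lp (fun _ : ℕ => ℂ) p) :
    prodTrunc p m x = (lpTrunc 2 m x.1, lpTrunc p m x.2) := rfl

theorem prodTrunc_prodTrunc_self (m : ℕ) (x : lp (fun _ : ℕ => ℂ) 2 × lp (fun _ : ℕ => ℂ) p) :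
    prodTrunc p m (prodTrunc p m x) = prodTrunc p m x := by
  simp only [prodTrunc_apply, lpTrunc_lpTrunc_self]

theorem norm_prodTrunc_le (m : ℕ) : ‖prodTrunc p m‖ ≤ 1 := by
  refine ContinuousLinearMap.opNorm_le_bound _ zero_le_one fun x => ?_
  refine max_le ?_ ?_
  · exact ((lpTrunc 2 m).le_of_opNorm_le (norm_lpTrunc_le m) x.1).trans
      (by gcongr; exact norm_fst_le x)
  · exact ((lpTrunc p m).le_of_opNorm_le (norm_lpTrunc_le m) x.2).trans
      (by gcongr; exact norm_snd_le x)

theorem tendsto_prodTrunc_comp_compact (hp : p ≠ ∞) {Y : Type*} [NormedAddCommGroup Y]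
    [NormedSpace ℂ Y] {T : Y →L[ℂ] lp (fun _ : ℕ => ℂ) 2 × lp (fun _ : ℕ => ℂ) p}
    (hT : IsCompactOperator T) : Tendsto (fun m => (prodTrunc p m).comp T) atTop (𝓝 T) := by
  have h0 : Tendsto (fun m => (prodTrunc p m - ContinuousLinearMap.id ℂ _).comp T) atTop
      (𝓝 0) := by
    refine tendsto_comp_compact_of_strongly_null (K := 1 + 1) (fun m => ?_) (fun x => ?_) hT
    · exact (norm_sub_le _ _).trans
        (add_le_add (norm_prodTrunc_le m) ContinuousLinearMap.norm_id_le)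
    · have h := ((tendsto_lpTrunc (by simp) x.1).prodMk_nhds (tendsto_lpTrunc hp x.2)).sub_const x
      rw [sub_self] at h
      exact h
  have h1 := h0.add_const T
  rw [zero_add] at h1
  refine h1.congr fun m => ?_
  ext1 x
  simp

/-- Truncation on the right needs decay of functionals on tails, available on each summand because
both exponents lie in (1, ∞); the two restrictions of `T` are then reassembled. -/
theorem tendsto_compact_comp_prodTrunc (hp1 : 1 < p) (hp : p ≠ ∞) {Y : Type*}
    [NormedAddCommGroup Y] [NormedSpace ℂ Y]
    {T : lp (fun _ : ℕ => ℂ) 2 × lp (fun _ : ℕ => ℂ) p →L[ℂ] Y} (hT : IsCompactOperator T) :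
    Tendsto (fun m => T.comp (prodTrunc p m)) atTop (𝓝 T) := by
  have h1 := tendsto_compact_comp_lpTrunc (p := 2) (by norm_num) (by simp)
    (T := T.comp (ContinuousLinearMap.inl ℂ _ _)) (hT.comp_clm (ContinuousLinearMap.inl ℂ _ _))
  have h2 := tendsto_compact_comp_lpTrunc hp1 hp
    (T := T.comp (ContinuousLinearMap.inr ℂ _ _)) (hT.comp_clm (ContinuousLinearMap.inr ℂ _ _))
  have h3 := ((((ContinuousLinearMap.compL ℂ
      (lp (fun _ : ℕ => ℂ) 2 × lp (fun _ : ℕ => ℂ) p) (lp (fun _ : ℕ => ℂ) 2) Y).flip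
      (ContinuousLinearMap.fst ℂ _ _)).continuous.tendsto _).comp h1).add
    ((((ContinuousLinearMap.compL ℂ
      (lp (fun _ : ℕ => ℂ) 2 × lp (fun _ : ℕ => ℂ) p) (lp (fun _ : ℕ => ℂ) p) Y).flip
      (ContinuousLinearMap.snd ℂ _ _)).continuous.tendsto _).comp h2)
  have hdec : ∀ x : lp (fun _ : ℕ => ℂ) 2 × lp (fun _ : ℕ => ℂ) p,
      T (x.1, 0) + T (0, x.2) = T x := fun x => by rw [← map_add]; simp
  exact (h3.congr fun m => ContinuousLinearMap.ext fun x => hdec (prodTrunc p m x)).mono_right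
    (congrArg 𝓝 (ContinuousLinearMap.ext hdec)).le

/-- Compact operators on `ℓ^2 ⊕ ℓ^p` are norm limits of their finite sections. -/
theorem tendsto_prodTrunc_comp_comp_prodTrunc (hp1 : 1 < p) (hp : p ≠ ∞)
    {T : lp (fun _ : ℕ => ℂ) 2 × lp (fun _ : ℕ => ℂ) p →L[ℂ]
      lp (fun _ : ℕ => ℂ) 2 × lp (fun _ : ℕ => ℂ) p} (hT : IsCompactOperator T) :
    Tendsto (fun m => (prodTrunc p m).comp (T.comp (prodTrunc p m))) atTop (𝓝 T) := by
  have h1 := tendsto_prodTrunc_comp_compact hp hT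
  have h2 := (tendsto_compact_comp_prodTrunc hp1 hp hT).sub_const T
  rw [sub_self] at h2
  have h3 : Tendsto (fun m => (prodTrunc p m).comp (T.comp (prodTrunc p m) - T)) atTop (𝓝 0) := by
    refine squeeze_zero_norm (fun m => ?_) (by simpa using h2.norm)
    exact ((prodTrunc p m).opNorm_comp_le _).trans
      (mul_le_of_le_one_left (norm_nonneg _) (norm_prodTrunc_le m))
  have h4 := h3.add h1
  rw [zero_add] at h4
  refine h4.congr fun m => ?_
  rw [ContinuousLinearMap.comp_sub, sub_add_cancel]

/-- The Hilbert summand goes into row 0 of ℓ^p by Rademacher functions and the ℓ^p summand fills row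
1, so the two do not interact. -/
theorem exists_prodTrunc_factorization (hp1 : 1 < p) (hp : p ≠ ∞) : ∃ K : ℝ, 1 ≤ K ∧ ∀ m : ℕ,
    ∃ (J : lp (fun _ : ℕ => ℂ) 2 × lp (fun _ : ℕ => ℂ) p →L[ℂ] lp (fun _ : ℕ => ℂ) p)
      (Q : lp (fun _ : ℕ => ℂ) p →L[ℂ] lp (fun _ : ℕ => ℂ) 2 × lp (fun _ : ℕ => ℂ) p),
      ‖J‖ ≤ K ∧ ‖Q‖ ≤ K ∧ (∀ x, Q (J x) = prodTrunc p m x) ∧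
        IsCompactOperator J ∧ IsCompactOperator Q := by
  obtain ⟨K, hK⟩ := exists_hilbert_complemented hp1 hp
  have hK0 : 0 ≤ K := by
    obtain ⟨J, _, hJ, _⟩ := hK 0
    exact (norm_nonneg _).trans hJ
  refine ⟨K + 1, by linarith, fun m => ?_⟩
  obtain ⟨J, Q, hJ, hQ, hQJ⟩ := hK m
  have hU := norm_lpRowEmbedding_le (p := p) hp
  have hV := norm_lpRow_le (p := p) hp
  have hc : IsCompactOperator (prodTrunc p m) := by
    have h1 := ((isCompactOperator_lpTrunc (p := 2) m).comp_clm (ContinuousLinearMap.fst ℂ _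
      (lp (fun _ : ℕ => ℂ) p))).clm_comp (ContinuousLinearMap.inl ℂ _ (lp (fun _ : ℕ => ℂ) p))
    have h2 := ((isCompactOperator_lpTrunc (p := p) m).comp_clm (ContinuousLinearMap.snd ℂ
      (lp (fun _ : ℕ => ℂ) 2) _)).clm_comp (ContinuousLinearMap.inr ℂ (lp (fun _ : ℕ => ℂ) 2) _)
    refine (congrArg IsCompactOperator (funext fun x => ?_)).mp (h1.add h2)
    simp [prodTrunc_apply]
  let J' : lp (fun _ : ℕ => ℂ) 2 × lp (fun _ : ℕ => ℂ) p →L[ℂ] lp (fun _ : ℕ => ℂ) p :=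
    ((lpRowEmbedding p hp 0).comp J).coprod (lpRowEmbedding p hp 1)
  let Q' : lp (fun _ : ℕ => ℂ) p →L[ℂ] lp (fun _ : ℕ => ℂ) 2 × lp (fun _ : ℕ => ℂ) p :=
    (Q.comp (lpRow p hp 0)).prod (lpRow p hp 1)
  have hJ' : ‖J'‖ ≤ K + 1 := by
    refine ContinuousLinearMap.opNorm_le_bound _ (by positivity) fun x => ?_
    have h1 := (lpRowEmbedding p hp 0).le_of_opNorm_le_of_le (hU 0)
      (J.le_of_opNorm_le_of_le hJ (norm_fst_le x))
    have h2 := (lpRowEmbedding p hp 1).le_of_opNorm_le_of_le (hU 1) (norm_snd_le x)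
    change ‖lpRowEmbedding p hp 0 (J x.1) + lpRowEmbedding p hp 1 x.2‖ ≤ _
    refine (norm_add_le _ _).trans ?_
    linarith
  have hQ' : ‖Q'‖ ≤ K + 1 := by
    refine ContinuousLinearMap.opNorm_le_bound _ (by positivity) fun x => ?_
    have h1 := Q.le_of_opNorm_le_of_le hQ ((lpRow p hp 0).le_of_opNorm_le (hV 0) x)
    have h2 := (lpRow p hp 1).le_of_opNorm_le (hV 1) x
    have h3 := mul_nonneg hK0 (norm_nonneg x)
    have h4 := norm_nonneg x
    exact max_le (h1.trans (by linarith)) (h2.trans (by linarith))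
  -- Already Q' J' truncates the Hilbert summand and fixes the other one; composing with the finite
  -- section on either side gives compactness and the exact product.
  refine ⟨J'.comp (prodTrunc p m), (prodTrunc p m).comp Q', ?_, ?_, fun x => ?_,
    hc.clm_comp J', hc.comp_clm Q'⟩
  · exact (J'.opNorm_comp_le _).trans
      ((mul_le_of_le_one_right (norm_nonneg _) (norm_prodTrunc_le m)).trans hJ')
  · exact ((prodTrunc p m).opNorm_comp_le _).trans
      ((mul_le_of_le_one_left (norm_nonneg _) (norm_prodTrunc_le m)).trans hQ')
  · have hQJ' : ∀ y, Q (J y) = lpTrunc 2 m y := fun y => DFunLike.congr_fun hQJ y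
    simp [J', Q', prodTrunc_apply, lpRow_lpRowEmbedding, hQJ', lpTrunc_lpTrunc_self]

end Main

end

theorem mainTheorem7 (p : ℝ≥0∞) [Fact (1 ≤ p)] (hp1 : 1 < p) (hp : p < ∞) (hp2 : p ≠ 2)
    (h : IsAmenableBanachAlgebra
      (lp (fun _ : ℕ => ℂ) p →L[ℂ] lp (fun _ : ℕ => ℂ) p)) :
    IsAmenableBanachAlgebra
      (EllInfty (CompactOperators (lp (fun _ : ℕ => ℂ) 2 × lp (fun _ : ℕ => ℂ) p))) := by
  obtain ⟨K, hK, hJQ⟩ := exists_prodTrunc_factorization hp1 hp.ne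
  choose J Q hJ hQ hQJ hJc hQc using hJQ
  exact isAmenable_ellInfty_compactOperators (lpRow p hp.ne) (lpRowEmbedding p hp.ne)
    (norm_lpRow_le hp.ne) (norm_lpRowEmbedding_le hp.ne)
    (fun n x => by rw [lpRow_lpRowEmbedding, if_pos rfl])
    (fun c M hc => exists_blockDiagonal hp.ne c hc) (prodTrunc p) J Q hJ hQ hQJ
    prodTrunc_prodTrunc_self hJc hQc (fun T hT => tendsto_prodTrunc_comp_comp_prodTrunc hp1 hp.ne hT)
    (ContinuousLinearMap.snd ℂ _ _) (ContinuousLinearMap.inr ℂ _ _)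
    ((ContinuousLinearMap.norm_snd_le _ _ _).trans hK)
    ((ContinuousLinearMap.norm_inr_le_one _ _ _).trans hK) (fun x => rfl) h
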